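/- Call a set $I\subseteq\omega$ \emph{$f$-closed}, for a total function $f\colon\omega\to\omega$, if $f(x)\in I$ and $f^{-1}(x)\subseteq I$ for all $x\in I$. An \emph{$f$-block} is a structure $(I,<,f\upharpoonright I)$, where $I\subseteq\omega$ is a finite non-empty $f$-closed interval that is not a disjoint union of two or more non-empty $f$-closed intervals, and $\{x\in\omega : x<y \text{ for all } y\in I\}$ is $f$-closed. The function $f$ is a \emph{block function} if every $a\in\omega$ belongs to some $f$-block. Let $cp_f(x)=\mathrm{card}(f^{-1}(x))$. A \emph{computable copy} of $(\omega,<)$ is a structure $(\omega,\prec)$ isomorphic to $(\omega,<)$ with $\prec$ computable. The \emph{degree spectrum} of $f$ on $(\omega,<)$ is the set of Turing degrees of the images of the graph of $f$ under the isomorphisms from $(\omega,<)$ onto its computable copies. A Turing degree is $\Delta_2$ if it contains a $\Delta_2$ set, i.e. a set that is both $\Sigma_2$ and $\Pi_2$ in the arithmetical hierarchy. \textbf{Theorem.} There exists a computable block function $f\colon\omega\to\omega$ such that: (1) the function $cp_f$ is not computable; (2) each $f$-block occurs infinitely often in $(\omega,<,f)$, i.e. for every $f$-block there are infinitely many $f$-blocks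 isomorphic to it; (3) the degree spectrum of $f$ on $(\omega,<)$ contains all $\Delta_2$ degrees. -/

import Mathlib

/-! ### Turing degrees of sets and relations, Δ₂ degrees -/

open Classical in
/-- The characteristic function of a set of natural numbers, as an oracle. -/
noncomputable def setOracle (S : Set ℕ) : ℕ →. ℕ :=
  fun n => Part.some (if n ∈ S then 1 else 0)

/-- The Turing degree of a set of natural numbers. -/
noncomputable def degSet (S : Set ℕ) : TuringDegree :=
  toAntisymmetrization TuringReducible (setOracle S)

/-- The Turing degree of a binary relation on `ℕ`, coded as a set of natural numbers through the
computable pairing bijection. -/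
noncomputable def degRel (R : ℕ → ℕ → Prop) : TuringDegree :=
  degSet {n | R n.unpair.1 n.unpair.2}

/-- `Σ₂` sets of the arithmetical hierarchy: `n ∈ S ↔ ∃ y, ∀ z, R n y z` with `R` computable. -/
def IsSigma2 (S : Set ℕ) : Prop :=
  ∃ R : ℕ × ℕ × ℕ → Prop, ComputablePred R ∧ ∀ n, n ∈ S ↔ ∃ y, ∀ z, R (n, y, z)

/-- `Δ₂` sets: both the set and its complement are `Σ₂`. -/
def IsDelta2 (S : Set ℕ) : Prop :=
  IsSigma2 S ∧ IsSigma2 Sᶜ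

/-- A Turing degree is `Δ₂` if it contains a `Δ₂` set. -/
def IsDelta2Degree (d : TuringDegree) : Prop :=
  ∃ S : Set ℕ, IsDelta2 S ∧ d = degSet S

/-! ### Computable copies of `(ω, <)` and degree spectra -/

/-- `(ω, r)` is a computable copy of `(ω, <)`. -/
def IsComputableCopy (r : ℕ → ℕ → Prop) : Prop :=
  ComputablePred (fun p : ℕ × ℕ => r p.1 p.2) ∧
    Nonempty (((· < ·) : ℕ → ℕ → Prop) ≃r r)

/-- The degree spectrum of a binary relation `R` on `(ω, <)`: the Turing degrees of the images of
`R` in all computable copies of `(ω, <)`. -/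
def degSpec (R : ℕ → ℕ → Prop) : Set TuringDegree :=
  {d | ∃ r : ℕ → ℕ → Prop, IsComputableCopy r ∧
    ∃ φ : ((· < ·) : ℕ → ℕ → Prop) ≃r r, d = degRel (Relation.Map R φ φ)}

/-- The degree spectrum of a unary total function, that is, of its graph. -/
def degSpecFun (f : ℕ → ℕ) : Set TuringDegree :=
  degSpec (fun x y => f x = y)

/-! ### Block functions -/

/-- `I` is closed under `f` and under `f`-preimages. -/
def FClosed (f : ℕ → ℕ) (I : Set ℕ) : Prop :=
  ∀ x ∈ I, f x ∈ I ∧ f ⁻¹' {x} ⊆ I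

/-- `I` is (the domain of) an `f`-block: a finite non-empty `f`-closed interval which is not a
disjoint union of several (non-empty) `f`-closed intervals, such that the set of all numbers lying
strictly to the left of `I` is `f`-closed. -/
structure IsFBlock (f : ℕ → ℕ) (I : Set ℕ) : Prop where
  finite : I.Finite
  nonempty : I.Nonempty
  interval : I.OrdConnected
  closed : FClosed f I
  indecomposable : ¬ ∃ P : Set (Set ℕ), P.Nontrivial ∧
    (∀ J ∈ P, J.Nonempty ∧ J.OrdConnected ∧ FClosed f J) ∧
    P.PairwiseDisjoint id ∧ ⋃₀ P = I
  left_closed : FClosed f {x | ∀ y ∈ I, x < y}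

/-- `f` is a block function: every number lies in an `f`-block. -/
def IsBlockFunction (f : ℕ → ℕ) : Prop :=
  ∀ a : ℕ, ∃ I : Set ℕ, IsFBlock f I ∧ a ∈ I

/-- The structures `(I, <, f ↾ I)` and `(J, <, f ↾ J)` are isomorphic (for `f`-closed `I`, `J`). -/
def SameFType (f : ℕ → ℕ) (I J : Set ℕ) : Prop :=
  ∃ e : I ≃o J, ∀ x y : I, f x = (y : ℕ) ↔ f (e x) = (e y : ℕ)

/-- The cardinality of the preimage of `x`. (For a block function this preimage is finite, since it
is contained in the block of `x`.) -/
noncomputable def cp (f : ℕ → ℕ) (x : ℕ) : ℕ :=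
  (f ⁻¹' {x}).ncard

/-!
The block function `f` is built in stages. If `k` elements are present, a stage appends an element
that is mapped to the beginning of an earlier stage, thereby merging everything from there on into
a single block, then two closed pairs, and finally a copy of `(k, f ↾ k)`. A stage is true if no
later stage merges anything that was present after it. There are infinitely many true stages, so
every block is complete at one of them, and the copies appended at later true stages repeat it
infinitely often.

The merges are chosen such that the true stages are the nondeficiency stages, in the sense of
Dekker, of an enumeration of the halting problem. As merges affect the sizes of preimages, `cp f`
decides which stages are true and hence computes the halting problem.

Given a computable approximation `a` to a `Δ₂` set, a copy of `(ω, <)` is built along with `f`. When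
a stage merges from some position on, the elements of the copy at or beyond this position move right
into the newly appended copy of the earlier part of `f`, so that `f` looks the same on them.
Membership of `n` is coded by a pair of consecutive elements, the first of which is mapped to the
second or to itself. When `a n` changes, the pair moves to one of the appended closed pairs, which
is of the other kind. An element moves only finitely often, since eventually it lies within what is
present after a true stage and the pairs of smaller index have stopped changing.
-/

/-! ### Closed sets and blocks -/

section Blocks

variable {f : ℕ → ℕ} {I J : Set ℕ} {a b : ℕ}

theorem fClosed_iff_preimage_eq : FClosed f I ↔ f ⁻¹' I = I := by
  refine ⟨fun hI => ?_, fun hI x hx => ⟨hI.superset hx, ?_⟩⟩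
  · exact Set.Subset.antisymm (fun x hx => (hI _ hx).2 rfl) fun x hx => (hI x hx).1
  · exact (Set.preimage_mono (Set.singleton_subset_iff.2 hx)).trans hI.subset

theorem fClosed_Iio_iff : FClosed f (Set.Iio a) ↔ ∀ i, i < a ↔ f i < a := by
  rw [fClosed_iff_preimage_eq, eq_comm, Set.ext_iff]
  rfl

theorem FClosed.diff (hI : FClosed f I) (hJ : FClosed f J) : FClosed f (I \ J) := by
  rw [fClosed_iff_preimage_eq] at *
  rw [Set.preimage_sdiff, hI, hJ]

theorem FClosed.union (hI : FClosed f I) (hJ : FClosed f J) : FClosed f (I ∪ J) := by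
  rw [fClosed_iff_preimage_eq] at *
  rw [Set.preimage_union, hI, hJ]

theorem FClosed.Ico (ha : FClosed f (Set.Iio a)) (hb : FClosed f (Set.Iio b)) :
    FClosed f (Set.Ico a b) := by
  have hdiff : Set.Iio b \ Set.Iio a = Set.Ico a b := by
    rw [Set.sdiff_eq, Set.compl_Iio, Set.Iio_inter_Ici]
  exact hdiff ▸ hb.diff ha

theorem FClosed.Iio_of_Ico (hab : a ≤ b) (ha : FClosed f (Set.Iio a))
    (hI : FClosed f (Set.Ico a b)) : FClosed f (Set.Iio b) :=
  Set.Iio_union_Ico_eq_Iio hab ▸ ha.union hI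

theorem exists_eq_Icc_of_finite_of_ordConnected {α : Type*} [LinearOrder α] {s : Set α}
    (hs : s.Finite) (hne : s.Nonempty) (hconn : s.OrdConnected) :
    ∃ a b, a ≤ b ∧ s = Set.Icc a b := by
  obtain ⟨a, ha, hmin⟩ := Set.exists_min_image s id hs hne
  obtain ⟨b, hb, hmax⟩ := Set.exists_max_image s id hs hne
  exact ⟨a, b, hmin b hb, Set.Subset.antisymm (fun x hx => ⟨hmin x hx, hmax x hx⟩)
    (hconn.out ha hb)⟩

theorem exists_eq_Ico_of_finite_of_ordConnected (hI : I.Finite) (hne : I.Nonempty)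
    (hconn : I.OrdConnected) : ∃ a b, a < b ∧ I = Set.Ico a b := by
  obtain ⟨a, b, hab, rfl⟩ := exists_eq_Icc_of_finite_of_ordConnected hI hne hconn
  exact ⟨a, b + 1, Nat.lt_succ_of_le hab, (Set.Ico_succ_right_eq_Icc a b).symm⟩

theorem setOf_forall_mem_Ico_lt (hab : a < b) : {x | ∀ y ∈ Set.Ico a b, x < y} = Set.Iio a :=
  Set.ext fun _ => ⟨fun hx => hx a ⟨le_rfl, hab⟩, fun hx _ hy => lt_of_lt_of_le hx hy.1⟩

theorem isFBlock_Ico (hab : a < b) (ha : FClosed f (Set.Iio a)) (hb : FClosed f (Set.Iio b))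
    (hcut : ∀ c, a < c → c < b → ¬ FClosed f (Set.Iio c)) : IsFBlock f (Set.Ico a b) where
  finite := Set.finite_Ico a b
  nonempty := Set.nonempty_Ico.2 hab
  interval := Set.ordConnected_Ico
  closed := ha.Ico hb
  left_closed := by rwa [setOf_forall_mem_Ico_lt hab]
  indecomposable := by
    rintro ⟨P, hP, hparts, hdisj, hcover⟩
    obtain ⟨J, hJP, haJ⟩ : a ∈ ⋃₀ P := hcover ▸ ⟨le_rfl, hab⟩
    have hsub {K : Set ℕ} (hK : K ∈ P) : K ⊆ Set.Ico a b := hcover ▸ Set.subset_sUnion_of_mem hK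
    obtain ⟨hJne, hJconn, hJcl⟩ := hparts J hJP
    obtain ⟨a', c, hac, rfl⟩ := exists_eq_Ico_of_finite_of_ordConnected
      ((Set.finite_Ico a b).subset (hsub hJP)) hJne hJconn
    obtain ⟨haa', hcb⟩ := (Set.Ico_subset_Ico_iff hac).1 (hsub hJP)
    obtain rfl : a' = a := le_antisymm haJ.1 haa'
    obtain rfl : c = b := hcb.eq_of_not_lt fun hlt => hcut c hac hlt (ha.Iio_of_Ico hac.le hJcl)
    obtain ⟨K, hKP, hKJ⟩ := hP.exists_ne (Set.Ico a' c)
    obtain ⟨y, hy⟩ := (hparts K hKP).1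
    exact Set.disjoint_left.1 (hdisj hKP hJP hKJ) hy (hsub hKP hy)

theorem IsFBlock.not_fClosed_Iio (hI : IsFBlock f (Set.Ico a b)) (ha : FClosed f (Set.Iio a))
    (hb : FClosed f (Set.Iio b)) {c : ℕ} (hac : a < c) (hcb : c < b) :
    ¬ FClosed f (Set.Iio c) := by
  intro hc
  have hne : Set.Ico a c ≠ Set.Ico c b := fun heq =>
    (heq ▸ Set.left_mem_Ico.2 hac : a ∈ Set.Ico c b).1.not_gt hac
  have hdisj : Disjoint (Set.Ico a c) (Set.Ico c b) := Set.Ico_disjoint_Ico_same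
  refine hI.indecomposable ⟨{Set.Ico a c, Set.Ico c b}, Set.nontrivial_pair hne, ?_, ?_, ?_⟩
  · rintro J (rfl | rfl)
    · exact ⟨Set.nonempty_Ico.2 hac, Set.ordConnected_Ico, ha.Ico hc⟩
    · exact ⟨Set.nonempty_Ico.2 hcb, Set.ordConnected_Ico, hc.Ico hb⟩
  · exact Set.pairwise_pair.2 fun _ => ⟨hdisj, hdisj.symm⟩
  · rw [Set.sUnion_pair, Set.Ico_union_Ico_eq_Ico hac.le hcb.le]

theorem IsFBlock.exists_eq_Ico (hI : IsFBlock f I) :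
    ∃ a b, a < b ∧ I = Set.Ico a b ∧ FClosed f (Set.Iio a) ∧ FClosed f (Set.Iio b) ∧
      ∀ c, a < c → c < b → ¬ FClosed f (Set.Iio c) := by
  obtain ⟨a, b, hab, rfl⟩ :=
    exists_eq_Ico_of_finite_of_ordConnected hI.finite hI.nonempty hI.interval
  have ha : FClosed f (Set.Iio a) := setOf_forall_mem_Ico_lt hab ▸ hI.left_closed
  have hb : FClosed f (Set.Iio b) := ha.Iio_of_Ico hab.le hI.closed
  exact ⟨a, b, hab, rfl, ha, hb, fun c => hI.not_fClosed_Iio ha hb⟩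

theorem isBlockFunction_of_forall_exists_fClosed_Iio
    (hf : ∀ a, ∃ c, a < c ∧ FClosed f (Set.Iio c)) : IsBlockFunction f := by
  classical
  intro x
  let P : ℕ → Prop := fun c => FClosed f (Set.Iio c)
  have ha : P (Nat.findGreatest P x) :=
    Nat.findGreatest_spec (Nat.zero_le x) fun y hy => absurd hy (Nat.not_lt_zero y)
  have hax : Nat.findGreatest P x ≤ x := Nat.findGreatest_le x
  obtain ⟨hxb, hb⟩ := Nat.find_spec (hf x)
  refine ⟨_, isFBlock_Ico (hax.trans_lt hxb) ha hb fun c hac hcb hc => ?_, hax, hxb⟩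
  rcases le_or_gt c x with hcx | hxc
  · exact Nat.findGreatest_is_greatest hac hcx hc
  · exact Nat.find_min (hf x) hcb ⟨hxc, hc⟩

theorem sameFType_image_const_add {c : ℕ} (hc : ∀ x ∈ I, f (c + x) = c + f x) :
    SameFType f I ((c + ·) '' I) := by
  refine ⟨⟨Equiv.Set.image _ I (add_right_injective c), ?_⟩, ?_⟩
  · rintro ⟨x, hx⟩ ⟨y, hy⟩
    exact Nat.add_le_add_iff_left
  · rintro ⟨x, hx⟩ ⟨y, hy⟩
    change f x = y ↔ f (c + x) = c + y
    rw [hc x hx, Nat.add_left_cancel_iff]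

theorem image_const_add_injective (hI : I.Nonempty) :
    Function.Injective fun c : ℕ => (c + ·) '' I := fun c d heq => by
  have hleast (e : ℕ) : IsLeast ((e + ·) '' I) (e + sInf I) :=
    Monotone.map_isLeast (fun _ _ hxy => Nat.add_le_add_left hxy e)
      ⟨Nat.sInf_mem hI, fun _ => Nat.sInf_le⟩
  have hleast_c := hleast c
  rw [show (c + ·) '' I = (d + ·) '' I from heq] at hleast_c
  exact Nat.add_right_cancel (hleast_c.unique (hleast d))

end Blocks

section PreimageCount

variable {f : ℕ → ℕ}

theorem IsBlockFunction.finite_preimage_singleton (hf : IsBlockFunction f) (x : ℕ) :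
    (f ⁻¹' {x}).Finite := by
  obtain ⟨I, hI, hxI⟩ := hf x
  exact hI.finite.subset (hI.closed x hxI).2

theorem IsBlockFunction.finite_preimage_Iio (hf : IsBlockFunction f) (c : ℕ) :
    (f ⁻¹' Set.Iio c).Finite :=
  (Set.finite_Iio c).preimage' fun x _ => hf.finite_preimage_singleton x

theorem IsBlockFunction.sum_cp_eq_ncard (hf : IsBlockFunction f) (c : ℕ) :
    ∑ x ∈ Finset.range c, cp f x = (f ⁻¹' Set.Iio c).ncard := by
  induction c with
  | zero => simp
  | succ c ih =>
    have hunion : f ⁻¹' Set.Iio (c + 1) = f ⁻¹' Set.Iio c ∪ f ⁻¹' {c} := by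
      rw [← Set.preimage_union, Set.union_singleton, ← Order.Iio_succ_eq_insert]
      rfl
    have hdisj : Disjoint (f ⁻¹' Set.Iio c) (f ⁻¹' {c}) :=
      Disjoint.preimage f (Set.disjoint_singleton_right.2 (lt_irrefl c))
    rw [Finset.sum_range_succ, ih, hunion, Set.ncard_union_eq hdisj (hf.finite_preimage_Iio c)
      (hf.finite_preimage_singleton c), cp]

theorem IsBlockFunction.fClosed_Iio_iff_sum_cp (hf : IsBlockFunction f) {c : ℕ}
    (hc : ∀ i < c, f i < c) :
    FClosed f (Set.Iio c) ↔ ∑ x ∈ Finset.range c, cp f x = c := by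
  have hcard : (Set.Iio c).ncard = c := by
    rw [Set.ncard_eq_toFinset_card', Set.toFinset_Iio, Nat.card_Iio]
  rw [hf.sum_cp_eq_ncard, fClosed_iff_preimage_eq]
  refine ⟨fun heq => by rw [heq, hcard], fun heq => ?_⟩
  exact (Set.eq_of_subset_of_ncard_le hc (heq.trans hcard.symm).le (hf.finite_preimage_Iio c)).symm

end PreimageCount

/-! ### The block function of a merge schedule -/

/-- The number of elements on which the block function is defined before stage `s`. -/
def stageLen : ℕ → ℕ
  | 0 => 0
  | s + 1 => 2 * stageLen s + 5

/-- The schedule by which the stages of the construction merge segments: at stage `s` everything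
added since the beginning of stage `target s` is merged, so `target s = s` means that nothing is.
The even stages are left idle in order to be available for coding. -/
structure MergeSchedule where
  target : ℕ → ℕ
  target_le : ∀ s, target s ≤ s
  target_le_target : ∀ {s j}, target s ≤ j → j ≤ s → target s ≤ target j
  target_two_mul : ∀ j, target (2 * j) = 2 * j
  frequently_lt_target : ∃ᶠ T in Filter.atTop, ∀ s, T < s → T < target s

theorem stageLen_succ (s : ℕ) : stageLen (s + 1) = 2 * stageLen s + 5 := rfl

theorem stageLen_strictMono : StrictMono stageLen :=
  strictMono_nat_of_lt_succ fun s => by rw [stageLen_succ]; omega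

theorem le_stageLen (s : ℕ) : s ≤ stageLen s := stageLen_strictMono.le_apply

theorem lt_stageLen_succ_cases {s i : ℕ} (hi : i < stageLen (s + 1)) :
    i < stageLen s ∨ ∃ j < stageLen s + 5, i = stageLen s + j := by
  rw [stageLen_succ] at hi
  rcases lt_or_ge i (stageLen s) with hlt | hge
  · exact .inl hlt
  · exact .inr ⟨i - stageLen s, by omega, by omega⟩

theorem stageLen_ne {s m : ℕ} (hsm : stageLen s < m) (hms : m < stageLen (s + 1)) (t : ℕ) :
    stageLen t ≠ m := by
  rintro rfl
  rw [stageLen_strictMono.lt_iff_lt] at hsm hms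
  omega

/-- The initial segment `[0, q)` is closed under `f` and `f`-preimages as far as elements below `l`
are concerned. -/
def IsCutBelow (f : ℕ → ℕ) (l q : ℕ) : Prop :=
  ∀ i < l, i < q ↔ f i < q

theorem fClosed_Iio_iff_forall_isCutBelow {f : ℕ → ℕ} {q : ℕ} :
    FClosed f (Set.Iio q) ↔ ∀ s, IsCutBelow f (stageLen s) q := by
  rw [fClosed_Iio_iff]
  exact ⟨fun hf s i _ => hf i, fun hf i => hf (i + 1) i (le_stageLen (i + 1))⟩

namespace MergeSchedule

variable (M : MergeSchedule)

/-- No stage after `T` merges anything that was added up to stage `T`. -/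
def IsTrueStage (T : ℕ) : Prop :=
  ∀ s, T < s → T < M.target s

theorem exists_isTrueStage_ge (N : ℕ) : ∃ T, N ≤ T ∧ M.IsTrueStage T :=
  Filter.frequently_atTop.1 M.frequently_lt_target N

/-- The list of the values of the block function below `stageLen s`. Stage `s` appends an element
mapped to the beginning of the merged segment, two fixed points, a pair with a common value, and a
copy of all that precedes. -/
def stageValues : ℕ → List ℕ
  | 0 => []
  | s + 1 => stageValues s ++
      ([stageLen (M.target s), stageLen s + 1, stageLen s + 2, stageLen s + 4, stageLen s + 4] ++
        (stageValues s).map (stageLen s + 5 + ·))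

/-- The block function built along a merge schedule, the union of the lists `stageValues`. -/
def blockFun (x : ℕ) : ℕ :=
  (M.stageValues (x + 1)).getD x 0

variable {M} {s i q : ℕ}

theorem stageLen_target_le (s : ℕ) : stageLen (M.target s) ≤ stageLen s :=
  stageLen_strictMono.monotone (M.target_le s)

theorem length_stageValues (s : ℕ) : (M.stageValues s).length = stageLen s := by
  induction s with
  | zero => rfl
  | succ s ih =>
    simp only [stageValues, List.length_append, ih, List.length_map, List.length_cons,
      List.length_nil, stageLen_succ]
    omega

theorem stageValues_getD_of_le {t : ℕ} (hst : s ≤ t) (hi : i < stageLen s) :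
    (M.stageValues t).getD i 0 = (M.stageValues s).getD i 0 := by
  induction t, hst using Nat.le_induction with
  | base => rfl
  | succ t hst ih =>
    rw [← ih, stageValues, List.getD_append]
    rw [length_stageValues]
    exact hi.trans_le (stageLen_strictMono.monotone hst)

theorem blockFun_eq_getD (hi : i < stageLen s) :
    M.blockFun i = (M.stageValues s).getD i 0 := by
  rcases le_total s (i + 1) with hs | hs
  · exact stageValues_getD_of_le hs hi
  · exact (stageValues_getD_of_le hs (le_stageLen (i + 1))).symm

theorem blockFun_stageLen_add (hi : i < stageLen s + 5) :
    M.blockFun (stageLen s + i) =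
      ([stageLen (M.target s), stageLen s + 1, stageLen s + 2, stageLen s + 4, stageLen s + 4] ++
        (M.stageValues s).map (stageLen s + 5 + ·)).getD i 0 := by
  rw [blockFun_eq_getD (s := s + 1) (by rw [stageLen_succ]; omega), stageValues,
    List.getD_append_right _ _ _ _ (by rw [length_stageValues]; omega), length_stageValues,
    Nat.add_sub_cancel_left]

theorem blockFun_stageLen (s : ℕ) : M.blockFun (stageLen s) = stageLen (M.target s) :=
  blockFun_stageLen_add (i := 0) (by omega)

theorem blockFun_stageLen_add_one (s : ℕ) : M.blockFun (stageLen s + 1) = stageLen s + 1 :=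
  blockFun_stageLen_add (by omega)

theorem blockFun_stageLen_add_two (s : ℕ) : M.blockFun (stageLen s + 2) = stageLen s + 2 :=
  blockFun_stageLen_add (by omega)

theorem blockFun_stageLen_add_three (s : ℕ) : M.blockFun (stageLen s + 3) = stageLen s + 4 :=
  blockFun_stageLen_add (by omega)

theorem blockFun_stageLen_add_four (s : ℕ) : M.blockFun (stageLen s + 4) = stageLen s + 4 :=
  blockFun_stageLen_add (by omega)

theorem blockFun_copy (hi : i < stageLen s) :
    M.blockFun (stageLen s + 5 + i) = stageLen s + 5 + M.blockFun i := by
  have hlen : i < (M.stageValues s).length := by rwa [length_stageValues]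
  rw [add_assoc, blockFun_stageLen_add (by omega), List.getD_append_right _ _ _ _ (by simp),
    blockFun_eq_getD hi, List.length_cons, List.length_cons, List.length_cons, List.length_cons,
    List.length_cons, List.length_nil, Nat.add_sub_cancel_left,
    List.getD_eq_getElem _ _ (by simpa using hlen), List.getD_eq_getElem _ _ hlen, List.getElem_map]

theorem forall_lt_stageLen_succ {P : ℕ → ℕ → Prop}
    (old : ∀ i < stageLen s, P i (M.blockFun i))
    (merge : P (stageLen s) (stageLen (M.target s)))
    (fixed : ∀ i, stageLen s < i → i < stageLen (s + 1) → P i i)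
    (step : P (stageLen s + 3) (stageLen s + 4))
    (copy : ∀ i < stageLen s, P (stageLen s + 5 + i) (stageLen s + 5 + M.blockFun i)) :
    ∀ i < stageLen (s + 1), P i (M.blockFun i) := by
  intro i hi
  rcases lt_stageLen_succ_cases hi with hi | ⟨j, hj, rfl⟩
  · exact old i hi
  have hfixed (h0 : 0 < j) (hval : M.blockFun (stageLen s + j) = stageLen s + j) :
      P (stageLen s + j) (M.blockFun (stageLen s + j)) :=
    hval.symm ▸ fixed _ (by omega) hi
  rcases lt_or_ge j 5 with hj5 | hj5
  · interval_cases j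
    · exact (blockFun_stageLen (M := M) s).symm ▸ merge
    · exact hfixed one_pos (blockFun_stageLen_add_one s)
    · exact hfixed two_pos (blockFun_stageLen_add_two s)
    · exact (blockFun_stageLen_add_three (M := M) s).symm ▸ step
    · exact hfixed four_pos (blockFun_stageLen_add_four s)
  · obtain ⟨i, rfl⟩ := Nat.exists_eq_add_of_le hj5
    rw [← add_assoc, blockFun_copy (by omega)]
    exact copy i (by omega)

theorem blockFun_lt (hi : i < stageLen s) : M.blockFun i < stageLen s := by
  induction s generalizing i with
  | zero => exact absurd hi (Nat.not_lt_zero i)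
  | succ s ih =>
    have htarget := M.stageLen_target_le s
    have hlen := stageLen_succ s
    refine forall_lt_stageLen_succ (P := fun _ y => y < stageLen (s + 1)) (fun i hi => ?_) ?_
      (fun _ _ => id) ?_ (fun i hi => ?_) i hi
    · exact (ih hi).trans (stageLen_strictMono s.lt_succ_self)
    · omega
    · omega
    · have := ih hi
      omega

theorem isCutBelow_of_stageLen_le (hq : stageLen s ≤ q) :
    IsCutBelow M.blockFun (stageLen s) q := fun _ hi =>
  iff_of_true (hi.trans_le hq) ((blockFun_lt hi).trans_le hq)

theorem isCutBelow_succ (hq : IsCutBelow M.blockFun (stageLen s) q)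
    (hle : q ≤ stageLen (M.target s)) : IsCutBelow M.blockFun (stageLen (s + 1)) q := by
  have htarget := M.stageLen_target_le s
  refine forall_lt_stageLen_succ (P := fun i y => i < q ↔ y < q) hq ?_ (fun _ _ _ => Iff.rfl) ?_
    fun i _ => ?_ <;> omega

theorem isCutBelow_copy (hq : IsCutBelow M.blockFun (stageLen s) q) :
    IsCutBelow M.blockFun (stageLen (s + 1)) (stageLen s + 5 + q) := by
  have htarget := M.stageLen_target_le s
  refine forall_lt_stageLen_succ
    (P := fun i y => i < stageLen s + 5 + q ↔ y < stageLen s + 5 + q)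
    (fun i hi => ?_) (by omega) (fun _ _ _ => Iff.rfl) (by omega) fun i hi => ?_
  · have := M.blockFun_lt hi
    omega
  · have := hq i hi
    omega

theorem isCutBelow_stageLen_add (hi : i = 1 ∨ i = 3) :
    IsCutBelow M.blockFun (stageLen (s + 1)) (stageLen s + i) := by
  have htarget := M.stageLen_target_le s
  refine forall_lt_stageLen_succ (P := fun x y => x < stageLen s + i ↔ y < stageLen s + i)
    (fun x hx => ?_) (by omega) (fun _ _ _ => Iff.rfl) (by omega) fun x _ => by omega
  have := M.blockFun_lt hx
  omega

theorem isCutBelow_stageLen_target (s : ℕ) :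
    IsCutBelow M.blockFun (stageLen s) (stageLen (M.target s)) := by
  suffices H : ∀ j, M.target s ≤ j → j ≤ s →
      IsCutBelow M.blockFun (stageLen j) (stageLen (M.target s)) from H s (M.target_le s) le_rfl
  intro j hj
  induction j, hj using Nat.le_induction with
  | base => exact fun _ => isCutBelow_of_stageLen_le le_rfl
  | succ j hj ih =>
    intro hjs
    exact isCutBelow_succ (ih (by omega))
      (stageLen_strictMono.monotone (M.target_le_target hj (by omega)))

theorem IsTrueStage.isCutBelow {T : ℕ} (hT : M.IsTrueStage T)
    (hq : IsCutBelow M.blockFun (stageLen (T + 1)) q) (hle : q ≤ stageLen (T + 1)) (s : ℕ) :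
    IsCutBelow M.blockFun (stageLen s) q := by
  rcases le_total s (T + 1) with hs | hs
  · exact fun i hi => hq i (hi.trans_le (stageLen_strictMono.monotone hs))
  · induction s, hs using Nat.le_induction with
    | base => exact hq
    | succ s hs ih =>
      exact isCutBelow_succ ih (hle.trans (stageLen_strictMono.monotone (hT s hs)))

theorem IsTrueStage.fClosed_Iio_iff {T : ℕ} (hT : M.IsTrueStage T) (hq : q ≤ stageLen (T + 1)) :
    FClosed M.blockFun (Set.Iio q) ↔ IsCutBelow M.blockFun (stageLen (T + 1)) q := by
  rw [fClosed_Iio_iff_forall_isCutBelow]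
  exact ⟨fun H => H _, fun H => hT.isCutBelow H hq⟩

theorem fClosed_Iio_stageLen_succ_iff {T : ℕ} :
    FClosed M.blockFun (Set.Iio (stageLen (T + 1))) ↔ M.IsTrueStage T := by
  refine ⟨fun hcl s hs => ?_, fun hT =>
    (hT.fClosed_Iio_iff le_rfl).2 (isCutBelow_of_stageLen_le le_rfl)⟩
  have hmerge := (_root_.fClosed_Iio_iff.1 hcl (stageLen s)).not
  rw [blockFun_stageLen, stageLen_strictMono.lt_iff_lt, stageLen_strictMono.lt_iff_lt] at hmerge
  omega

theorem isBlockFunction_blockFun : IsBlockFunction M.blockFun :=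
  isBlockFunction_of_forall_exists_fClosed_Iio fun a => by
    obtain ⟨T, haT, hT⟩ := M.exists_isTrueStage_ge a
    exact ⟨_, haT.trans_lt (le_stageLen (T + 1)), fClosed_Iio_stageLen_succ_iff.2 hT⟩

theorem IsTrueStage.fClosed_Iio_copy_iff {T : ℕ} (hT : M.IsTrueStage T) (hq : q ≤ stageLen T) :
    FClosed M.blockFun (Set.Iio (stageLen T + 5 + q)) ↔
      IsCutBelow M.blockFun (stageLen T) q := by
  rw [hT.fClosed_Iio_iff (by rw [stageLen_succ]; omega)]
  refine ⟨fun H i hi => ?_, isCutBelow_copy⟩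
  have := H (stageLen T + 5 + i) (by rw [stageLen_succ]; omega)
  rw [blockFun_copy hi] at this
  omega

theorem IsTrueStage.isFBlock_copy {T₀ T : ℕ} (hT₀ : M.IsTrueStage T₀) (hT : M.IsTrueStage T)
    (hlt : T₀ < T) {I : Set ℕ} (hI : IsFBlock M.blockFun I)
    (hIT : I ⊆ Set.Iio (stageLen (T₀ + 1))) : IsFBlock M.blockFun ((stageLen T + 5 + ·) '' I) := by
  obtain ⟨a, b, hab, rfl, ha, hb, hcut⟩ := hI.exists_eq_Ico
  have hT₀T : stageLen (T₀ + 1) ≤ stageLen T := stageLen_strictMono.monotone hlt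
  have hbT : b ≤ stageLen (T₀ + 1) := by
    have := hIT (show b - 1 ∈ Set.Ico a b by rw [Set.mem_Ico]; omega)
    rw [Set.mem_Iio] at this
    omega
  rw [fClosed_Iio_iff_forall_isCutBelow] at ha hb
  rw [Set.image_const_add_Ico]
  refine isFBlock_Ico (by omega) ((hT.fClosed_Iio_copy_iff (by omega)).2 (ha T))
    ((hT.fClosed_Iio_copy_iff (by omega)).2 (hb T)) fun c hac hcb hcl => ?_
  obtain ⟨d, rfl⟩ := Nat.exists_eq_add_of_le (show stageLen T + 5 ≤ c by omega)
  rw [hT.fClosed_Iio_copy_iff (by omega)] at hcl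
  exact hcut d (by omega) (by omega)
    ((hT₀.fClosed_Iio_iff (by omega)).2 fun i hi => hcl i (hi.trans_le hT₀T))

theorem infinite_setOf_isFBlock_sameFType {I : Set ℕ} (hI : IsFBlock M.blockFun I) :
    {J : Set ℕ | IsFBlock M.blockFun J ∧ SameFType M.blockFun I J}.Infinite := by
  obtain ⟨m, hm⟩ := hI.finite.bddAbove
  obtain ⟨T₀, hmT, hT₀⟩ := M.exists_isTrueStage_ge m
  have hIT : I ⊆ Set.Iio (stageLen (T₀ + 1)) := fun x hx =>
    ((hm hx).trans hmT).trans_lt (le_stageLen (T₀ + 1))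
  have hinf : {T | T₀ < T ∧ M.IsTrueStage T}.Infinite :=
    Set.infinite_of_forall_exists_gt fun n => by
      obtain ⟨T, hT⟩ := M.exists_isTrueStage_ge (n + T₀ + 1)
      exact ⟨T, ⟨by omega, hT.2⟩, by omega⟩
  have hinj : Function.Injective fun T => (stageLen T + 5 + ·) '' I :=
    (image_const_add_injective hI.nonempty).comp fun T T' heq =>
      stageLen_strictMono.injective (Nat.add_right_cancel heq)
  refine Set.infinite_of_injOn_mapsTo hinj.injOn (fun T hT => ?_) hinf
  refine ⟨hT₀.isFBlock_copy hT.2 hT.1 hI hIT, sameFType_image_const_add fun x hx => ?_⟩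
  exact blockFun_copy ((hIT hx).trans_le (stageLen_strictMono.monotone hT.1))

end MergeSchedule

/-! ### Schedules with the true stages of an enumeration -/

section DekkerSchedule

variable {h : ℕ → ℕ} {s i : ℕ}

/-- The merge target that makes `T` a true stage exactly if no value of `h` after `T` is smaller
than `h T`. -/
def dekkerTarget (h : ℕ → ℕ) (s : ℕ) : ℕ :=
  Nat.findGreatest (fun i => h (i - 1) ≤ h s) s

theorem dekkerTarget_le (h : ℕ → ℕ) (s : ℕ) : dekkerTarget h s ≤ s :=
  Nat.findGreatest_le s

theorem le_dekkerTarget (hi : i ≤ s) (hle : h (i - 1) ≤ h s) : i ≤ dekkerTarget h s :=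
  Nat.le_findGreatest hi hle

theorem apply_dekkerTarget_sub_one_le (hs : dekkerTarget h s ≠ 0) :
    h (dekkerTarget h s - 1) ≤ h s :=
  Nat.findGreatest_of_ne_zero (P := fun i => h (i - 1) ≤ h s) rfl hs

theorem lt_apply_of_dekkerTarget_le (hi : dekkerTarget h s ≤ i) (his : i < s) : h s < h i :=
  not_le.1 (Nat.findGreatest_is_greatest (P := fun i => h (i - 1) ≤ h s)
    (Nat.lt_succ_of_le hi) his)

theorem dekkerTarget_le_dekkerTarget {j : ℕ} (hj : dekkerTarget h s ≤ j) (hjs : j ≤ s) :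
    dekkerTarget h s ≤ dekkerTarget h j := by
  rcases hjs.eq_or_lt with rfl | hjs
  · rfl
  rcases eq_or_ne (dekkerTarget h s) 0 with h0 | h0
  · omega
  · exact le_dekkerTarget hj
      ((apply_dekkerTarget_sub_one_le h0).trans (lt_apply_of_dekkerTarget_le hj hjs).le)

theorem forall_lt_dekkerTarget_iff {T : ℕ} :
    (∀ s, T < s → T < dekkerTarget h s) ↔ ∀ s, T < s → h T ≤ h s := by
  refine ⟨fun hT s hs => ?_, fun hT s hs => le_dekkerTarget (i := T + 1) hs (hT s hs)⟩
  induction s using Nat.strong_induction_on with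
  | h s ih =>
    have hlt := hT s hs
    have hle := dekkerTarget_le h s
    refine le_trans ?_ (apply_dekkerTarget_sub_one_le (by omega))
    rcases Nat.eq_or_lt_of_le (Nat.le_sub_one_of_lt hlt) with heq | hlt'
    · exact (congrArg h heq).le
    · exact ih _ (by omega) hlt'

theorem frequently_forall_le (h : ℕ → ℕ) :
    ∃ᶠ T in Filter.atTop, ∀ s, T < s → h T ≤ h s := by
  refine Filter.frequently_atTop.2 fun N => ?_
  have hN : N ∈ Set.Ici N := Set.mem_Ici.2 le_rfl
  have hT := Function.argminOn_mem h (Set.Ici N) ⟨N, hN⟩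
  exact ⟨_, hT, fun s hs => Function.argminOn_le h (Set.Ici N) (le_trans hT hs.le)⟩

/-- The merge schedule whose true stages are those of `h` in the sense of Dekker. -/
def dekkerSchedule (h : ℕ → ℕ) (h_le : ∀ s, h s ≤ s) (h_two_mul : ∀ j, h (2 * j) = 2 * j) :
    MergeSchedule where
  target := dekkerTarget h
  target_le := dekkerTarget_le h
  target_le_target := dekkerTarget_le_dekkerTarget
  target_two_mul j := by
    refine (dekkerTarget_le h _).antisymm (le_dekkerTarget le_rfl ?_)
    exact (h_le _).trans ((Nat.sub_le _ 1).trans (h_two_mul j).ge)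
  frequently_lt_target := (frequently_forall_le h).mono fun _ => forall_lt_dekkerTarget_iff.2

theorem primrec_dekkerTarget (hh : Primrec h) : Primrec (dekkerTarget h) :=
  Primrec.nat_findGreatest Primrec.id
    (Primrec.nat_le.comp (hh.comp (Primrec.pred.comp Primrec.snd)) (hh.comp Primrec.fst))

end DekkerSchedule

section WitnessEnum

variable {p : ℕ → ℕ → Bool} {e k : ℕ}

/-- The enumeration of the numbers `e` with `∃ k, p e k` that lists `e` at the odd stage
corresponding to the pair of `e` and the witness `k`, and equals the identity at all other
stages. -/
def witnessEnum (p : ℕ → ℕ → Bool) (s : ℕ) : ℕ :=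
  bif s.bodd && p s.div2.unpair.1 s.div2.unpair.2 then s.div2.unpair.1 else s

theorem witnessEnum_two_mul (p : ℕ → ℕ → Bool) (j : ℕ) : witnessEnum p (2 * j) = 2 * j := by
  simp [witnessEnum]

theorem witnessEnum_eq_of_witness (hk : p e k = true) :
    witnessEnum p (2 * Nat.pair e k + 1) = e := by
  simp [witnessEnum, hk]

theorem exists_witness_of_witnessEnum_ne {s : ℕ} (hs : witnessEnum p s ≠ s) :
    ∃ k, s = 2 * Nat.pair (witnessEnum p s) k + 1 ∧ p (witnessEnum p s) k = true := by
  rw [witnessEnum] at hs ⊢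
  rcases hb : s.bodd && p s.div2.unpair.1 s.div2.unpair.2
  · exact absurd (hb ▸ rfl) hs
  · rw [Bool.and_eq_true] at hb
    refine ⟨s.div2.unpair.2, ?_, hb.2⟩
    have hs := Nat.bodd_add_div2 s
    rw [hb.1] at hs
    simp only [Bool.toNat_true] at hs
    simp only [cond_true, Nat.pair_unpair]
    omega

theorem witnessEnum_le (p : ℕ → ℕ → Bool) (s : ℕ) : witnessEnum p s ≤ s := by
  by_cases hs : witnessEnum p s = s
  · exact hs.le
  · obtain ⟨k, hsk, -⟩ := exists_witness_of_witnessEnum_ne hs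
    have := Nat.left_le_pair (witnessEnum p s) k
    omega

theorem tendsto_witnessEnum (hp : ∀ e k l, p e k = true → p e l = true → k = l) :
    Filter.Tendsto (witnessEnum p) Filter.atTop Filter.atTop := by
  rw [← Nat.cofinite_eq_atTop]
  refine Filter.Tendsto.cofinite_of_finite_preimage_singleton fun e => ?_
  have hsub : {s | witnessEnum p s = e ∧ s ≠ e}.Subsingleton := by
    rintro s ⟨rfl, hs⟩ t ⟨hts, ht⟩
    obtain ⟨k, hsk, hk⟩ := exists_witness_of_witnessEnum_ne hs.symm
    obtain ⟨l, htl, hl⟩ := exists_witness_of_witnessEnum_ne (hts.trans_ne ht.symm)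
    rw [hts] at htl hl
    rw [hsk, htl, hp _ _ _ hk hl]
  refine (hsub.finite.insert e).subset fun s hs => ?_
  exact (eq_or_ne s e).imp_right fun hne => ⟨hs, hne⟩

/-- The merge schedule of the enumeration `witnessEnum p`. -/
def witnessSchedule (p : ℕ → ℕ → Bool) : MergeSchedule :=
  dekkerSchedule (witnessEnum p) (witnessEnum_le p) (witnessEnum_two_mul p)

theorem isTrueStage_witnessSchedule_iff {T : ℕ} :
    (witnessSchedule p).IsTrueStage T ↔ ∀ s, T < s → witnessEnum p T ≤ witnessEnum p s :=
  forall_lt_dekkerTarget_iff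

theorem not_exists_witness_iff (hp : ∀ e k l, p e k = true → p e l = true → k = l) :
    (¬ ∃ k, p e k = true) ↔ ∃ T, (witnessSchedule p).IsTrueStage T ∧ e < witnessEnum p T ∧
      ∀ k < T, p e k = false := by
  constructor
  · intro he
    obtain ⟨T, hT, heT⟩ := ((witnessSchedule p).frequently_lt_target.and_eventually
      ((tendsto_witnessEnum hp).eventually_gt_atTop e)).exists
    exact ⟨T, hT, heT, fun k _ => Bool.eq_false_iff.2 fun hk => he ⟨k, hk⟩⟩
  · rintro ⟨T, hT, heT, hfalse⟩ ⟨k, hk⟩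
    have hlate : 2 * Nat.pair e k + 1 ≤ T := by
      by_contra! hlt
      have := isTrueStage_witnessSchedule_iff.1 hT _ hlt
      rw [witnessEnum_eq_of_witness hk] at this
      omega
    have hkT : k < T := by
      have := Nat.right_le_pair e k
      omega
    exact absurd hk (by rw [hfalse k hkT]; exact Bool.false_ne_true)

end WitnessEnum

/-! ### Computability of the block function and noncomputability of its preimage count -/

theorem primrec_stageLen : Primrec stageLen := by
  refine (Primrec.nat_rec₁ 0 (f := fun _ l => 2 * l + 5) ?_).of_eq fun s => ?_
  · exact Primrec.nat_add.comp (Primrec.nat_mul.comp (Primrec.const 2) Primrec.snd)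
      (Primrec.const 5)
  · induction s with
    | zero => rfl
    | succ s ih => rw [stageLen_succ, ← ih]

theorem MergeSchedule.primrec_stageValues {M : MergeSchedule} (hM : Primrec M.target) :
    Primrec M.stageValues := by
  refine (Primrec.nat_rec₁ [] (f := fun s l => l ++
    ([stageLen (M.target s), stageLen s + 1, stageLen s + 2, stageLen s + 4, stageLen s + 4] ++
      l.map (stageLen s + 5 + ·))) ?_).of_eq fun s => ?_
  · have hlen (c : ℕ) : Primrec fun q : ℕ × List ℕ => stageLen q.1 + c :=
      Primrec.nat_add.comp (primrec_stageLen.comp Primrec.fst) (Primrec.const c)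
    have hmerge : Primrec fun q : ℕ × List ℕ => stageLen (M.target q.1) :=
      primrec_stageLen.comp (hM.comp Primrec.fst)
    have hcons {g : ℕ × List ℕ → ℕ} {l : ℕ × List ℕ → List ℕ} (hg : Primrec g)
        (hl : Primrec l) : Primrec fun q => g q :: l q := Primrec.list_cons.comp hg hl
    refine Primrec.list_append.comp Primrec.snd (Primrec.list_append.comp ?_ ?_)
    · exact hcons hmerge <| hcons (hlen 1) <| hcons (hlen 2) <| hcons (hlen 4) <|
        hcons (hlen 4) <| Primrec.const []
    · exact Primrec.list_map Primrec.snd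
        (Primrec.nat_add.comp ((hlen 5).comp Primrec.fst) Primrec.snd).to₂
  · induction s with
    | zero => rfl
    | succ s ih => rw [stageValues, ← ih]

theorem MergeSchedule.primrec_blockFun {M : MergeSchedule} (hM : Primrec M.target) :
    Primrec M.blockFun :=
  (Primrec.list_getD 0).comp ((primrec_stageValues hM).comp Primrec.succ) Primrec.id

theorem primrec_witnessEnum {p : ℕ → ℕ → Bool} (hp : Primrec₂ p) : Primrec (witnessEnum p) := by
  have hunpair : Primrec fun s : ℕ => s.div2.unpair := Primrec.unpair.comp Primrec.nat_div2
  exact Primrec.cond (Primrec.and.comp Primrec.nat_bodd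
    (hp.comp (Primrec.fst.comp hunpair) (Primrec.snd.comp hunpair)))
    (Primrec.fst.comp hunpair) Primrec.id

section Halting

open Nat.Partrec (Code)
open Nat.Partrec.Code (evaln eval)

theorem computable_sum_range {g : ℕ → ℕ} (hg : Computable g) :
    Computable fun c => ∑ x ∈ Finset.range c, g x := by
  refine (Computable.nat_rec (f := fun c : ℕ => c) (g := fun _ => 0)
    (h := fun _ p => p.2 + g p.1) Computable.id (Computable.const 0) ?_).of_eq fun c => ?_
  · exact (Primrec.nat_add.to_comp.comp (Computable.snd.comp Computable.snd)
      (hg.comp (Computable.fst.comp Computable.snd))).to₂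
  · induction c with
    | zero => rfl
    | succ c ih => rw [Finset.sum_range_succ, ← ih]

theorem rePred_exists_of_computable₂ {α : Type*} [Primcodable α] {p : α → ℕ → Bool}
    (hp : Computable₂ p) : REPred fun x => ∃ n, p x n = true := by
  refine (Partrec.rfind hp.partrec₂).dom_re.of_eq fun x => ?_
  refine Nat.rfind_dom'.trans (exists_congr fun n => ?_)
  exact (and_iff_left_of_imp fun _ _ _ => trivial).trans
    ((Part.mem_some_iff (a := p x n)).trans eq_comm)

/-- The program with code number `e` halts on input `0` within `k` steps and not within fewer. -/
def haltsFirstAt (e k : ℕ) : Bool :=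
  (evaln k (Denumerable.ofNat Code e) 0).isSome &&
    decide (∀ j < k, (evaln j (Denumerable.ofNat Code e) 0).isSome = false)

theorem haltsFirstAt_unique (e k l : ℕ) (hk : haltsFirstAt e k = true)
    (hl : haltsFirstAt e l = true) : k = l := by
  simp only [haltsFirstAt, Bool.and_eq_true, decide_eq_true_eq] at hk hl
  refine le_antisymm (not_lt.1 fun hlt => ?_) (not_lt.1 fun hlt => ?_)
  · exact Bool.false_ne_true ((hk.2 l hlt).symm.trans hl.1)
  · exact Bool.false_ne_true ((hl.2 k hlt).symm.trans hk.1)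

theorem exists_haltsFirstAt_encode_iff (c : Code) :
    (∃ k, haltsFirstAt (Encodable.encode c) k = true) ↔ (eval c 0).Dom := by
  have hdom : (eval c 0).Dom ↔ ∃ k, (evaln k c 0).isSome = true := by
    simp only [Part.dom_iff_mem, Nat.Partrec.Code.evaln_complete, Option.isSome_iff_exists,
      Option.mem_def]
    exact exists_comm
  simp only [haltsFirstAt, Denumerable.ofNat_encode, hdom]
  constructor
  · rintro ⟨k, hk⟩
    exact ⟨k, (Bool.and_eq_true_iff.1 hk).1⟩
  · intro hex
    refine ⟨Nat.find hex, Bool.and_eq_true_iff.2 ⟨Nat.find_spec hex, ?_⟩⟩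
    exact decide_eq_true fun j hj => Bool.eq_false_iff.2 (Nat.find_min hex hj)

theorem primrec_haltsFirstAt : Primrec₂ haltsFirstAt := by
  have hsome : Primrec₂ fun k e : ℕ => (evaln k (Denumerable.ofNat Code e) 0).isSome :=
    Primrec.option_isSome.comp (Nat.Partrec.Code.primrec_evaln.comp (Primrec.pair
      (Primrec.pair Primrec.fst ((Primrec.ofNat Code).comp Primrec.snd)) (Primrec.const 0)))
  have hfalse : PrimrecRel fun k e : ℕ =>
      (evaln k (Denumerable.ofNat Code e) 0).isSome = false :=
    Primrec.eq.comp₂ hsome (Primrec.const false).to₂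
  exact Primrec.and.comp (hsome.comp Primrec.snd Primrec.fst)
    (hfalse.forall_lt.comp Primrec.snd Primrec.fst).decide

theorem not_halts_iff (c : Code) :
    ¬ (eval c 0).Dom ↔ ∃ T, (witnessSchedule haltsFirstAt).IsTrueStage T ∧
      Encodable.encode c < witnessEnum haltsFirstAt T ∧
        ∀ k < T, haltsFirstAt (Encodable.encode c) k = false :=
  (exists_haltsFirstAt_encode_iff c).not.symm.trans
    (not_exists_witness_iff (p := haltsFirstAt) haltsFirstAt_unique)

theorem MergeSchedule.isTrueStage_iff_sum_cp {M : MergeSchedule} {T : ℕ} :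
    M.IsTrueStage T ↔ ∑ x ∈ Finset.range (stageLen (T + 1)), cp M.blockFun x =
      stageLen (T + 1) := by
  rw [← fClosed_Iio_stageLen_succ_iff,
    isBlockFunction_blockFun.fClosed_Iio_iff_sum_cp fun i hi => blockFun_lt hi]

theorem not_computable_cp : ¬ Computable (cp (witnessSchedule haltsFirstAt).blockFun) := by
  intro hcp
  refine ComputablePred.halting_problem_not_re 0 ?_
  let cpSum : ℕ → ℕ := fun c => ∑ x ∈ Finset.range c, cp (witnessSchedule haltsFirstAt).blockFun x
  let p : Code → ℕ → Bool := fun c T =>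
    decide (cpSum (stageLen (T + 1)) = stageLen (T + 1)) &&
      (decide (Encodable.encode c < witnessEnum haltsFirstAt T) &&
        decide (∀ k < T, haltsFirstAt (Encodable.encode c) k = false))
  have hp : Computable₂ p := by
    have hlen : Computable fun q : Code × ℕ => stageLen (q.2 + 1) :=
      (primrec_stageLen.comp (Primrec.succ.comp Primrec.snd)).to_comp
    have hfalse : PrimrecRel fun (k : ℕ) (e : ℕ) => haltsFirstAt e k = false :=
      Primrec.eq.comp₂ (primrec_haltsFirstAt.comp₂ Primrec₂.right Primrec₂.left)
        (Primrec.const false).to₂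
    refine Primrec.and.to_comp.comp
      (Primrec.eq.decide.to_comp.comp ((computable_sum_range hcp).comp hlen) hlen) ?_
    exact (Primrec.and.comp
      (Primrec.nat_lt.decide.comp (Primrec.encode.comp Primrec.fst)
        ((primrec_witnessEnum primrec_haltsFirstAt).comp Primrec.snd))
      (hfalse.forall_lt.comp Primrec.snd (Primrec.encode.comp Primrec.fst)).decide).to_comp
  refine (rePred_exists_of_computable₂ hp).of_eq fun c => ?_
  simp only [not_halts_iff, MergeSchedule.isTrueStage_iff_sum_cp, p, cpSum, Bool.and_eq_true,
    decide_eq_true_eq]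

end Halting

/-! ### Construction of a computable copy -/

/-- The stage at which the pair of elements coding `n` enters the copy. -/
def codeStage (n : ℕ) : ℕ := 2 * Nat.pair n 0

/-- The first of the two elements of the copy that code whether `n` belongs to the given set. The
second one is its successor. -/
def codeName (n : ℕ) : ℕ := stageLen (codeStage n) + 1

/-- The new position of an element that had position `i` before a stage at which `k` elements
are present. Everything from position `b` on is moved into a copy of `[0, k)`, except that for
`g ≠ 0` the elements at `b` and `b + 1` are moved to `k + g` and `k + g + 1`. -/
def oldPos (k b g i : ℕ) : ℕ :=
  if i < b then i else if g ≠ 0 ∧ i < b + 2 then k + g + (i - b) else k + 5 + i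

/-- The position of the `j`-th new element: the new elements fill in increasing order the
positions left free by `oldPos k b g`. -/
def newPos (k b g j : ℕ) : ℕ :=
  if g ≠ 0 ∧ k + g ≤ b + j then b + j + 2 else b + j

theorem codeStage_lt {n j : ℕ} (hj : j ≠ 0) : codeStage n < 2 * Nat.pair n j := by
  have := Nat.pair_lt_pair_right n (Nat.pos_of_ne_zero hj)
  rw [codeStage]
  omega

theorem le_codeStage (n : ℕ) : n ≤ codeStage n := by
  have := Nat.left_le_pair n 0
  rw [codeStage]
  omega

theorem codeStage_strictMono : StrictMono codeStage := fun _ _ hmn =>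
  Nat.mul_lt_mul_of_pos_left (Nat.pair_lt_pair_left 0 hmn) two_pos

theorem codeName_strictMono : StrictMono codeName := fun _ _ hmn =>
  Nat.succ_lt_succ (stageLen_strictMono (codeStage_strictMono hmn))

theorem codeName_succ_ne (m n : ℕ) : codeName m + 1 ≠ codeName n := fun heq => by
  refine stageLen_ne (s := codeStage m) (m := codeName m) (by rw [codeName]; omega)
    (by rw [codeName, stageLen_succ]; omega) (codeStage n) ?_
  exact (Nat.succ_injective heq).symm

theorem codeName_succ_lt {n s : ℕ} (hn : codeStage n < s) : codeName n + 1 < stageLen s := by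
  have := stageLen_strictMono.monotone (Nat.succ_le_of_lt hn)
  rw [Nat.succ_eq_add_one, stageLen_succ] at this
  rw [codeName]
  omega

theorem oldPos_of_lt {k b g i : ℕ} (hi : i < b) : oldPos k b g i = i :=
  if_pos hi

theorem oldPos_add {k b g j : ℕ} (hg : g ≠ 0) (hj : j < 2) :
    oldPos k b g (b + j) = k + g + j := by
  rw [oldPos, if_neg (by omega), if_pos (by omega), Nat.add_sub_cancel_left]

theorem oldPos_self {k b g : ℕ} (hg : g ≠ 0) : oldPos k b g b = k + g :=
  oldPos_add hg two_pos

theorem oldPos_of_le {k b g i : ℕ} (hb : b ≤ i) (hi : g ≠ 0 → b + 2 ≤ i) :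
    oldPos k b g i = k + 5 + i := by
  rw [oldPos, if_neg (by omega), if_neg (by omega)]

theorem oldPos_lt {k b g i : ℕ} (hg : g ≤ 3) (hi : i < k) : oldPos k b g i < 2 * k + 5 := by
  unfold oldPos; split_ifs <;> omega

theorem oldPos_strictMono {k b g : ℕ} (hg : g ≤ 3) (hb : b ≤ k) : StrictMono (oldPos k b g) := by
  intro i j hij
  unfold oldPos; split_ifs <;> omega

theorem newPos_lt {k b g j : ℕ} (hb : b ≤ k) (hbg : g ≠ 0 → b + 2 ≤ k) (hj : j < k + 5) :
    newPos k b g j < 2 * k + 5 := by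
  unfold newPos; split_ifs <;> omega

theorem newPos_strictMono (k b g : ℕ) : StrictMono (newPos k b g) := by
  intro i j hij
  unfold newPos; split_ifs <;> omega

theorem oldPos_ne_newPos {k b g i j : ℕ} (hg : g ≤ 3) (hi : i < k) (hj : j < k + 5) :
    oldPos k b g i ≠ newPos k b g j := by
  unfold oldPos newPos; split_ifs <;> omega

namespace MergeSchedule

section Moves

variable {M : MergeSchedule} {s q b g : ℕ}

/-- The pair `q`, `q + 1` is closed in the part of the block function built before stage `s`, its
second element is a fixed point, and no stage starts between its elements. -/
structure IsCodePos (M : MergeSchedule) (s q : ℕ) : Prop where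
  isCutBelow : IsCutBelow M.blockFun (stageLen s) q
  isCutBelow_add_two : IsCutBelow M.blockFun (stageLen s) (q + 2)
  blockFun_eq_or : M.blockFun q = q ∨ M.blockFun q = q + 1
  blockFun_succ : M.blockFun (q + 1) = q + 1
  stageLen_ne : ∀ t, stageLen t ≠ q + 1

/-- Conditions under which the movement `oldPos (stageLen s) b g` does not affect the block
function, except at a code position `b` in the case `g ≠ 0`. The offsets `1` and `3` are those of
the two closed pairs that stage `s` appends, the first with two fixed points and the second with a
common value. -/
structure IsAdmissibleMove (M : MergeSchedule) (s b g : ℕ) : Prop where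
  le_stageLen_target : b ≤ stageLen (M.target s)
  isCutBelow : IsCutBelow M.blockFun (stageLen s) b
  gadget : g = 0 ∨ (g = 1 ∨ g = 3) ∧ b + 2 ≤ stageLen s ∧ M.IsCodePos s b

namespace IsCodePos

theorem of_le_stageLen_target (hq : M.IsCodePos s q) (hle : q + 2 ≤ stageLen (M.target s)) :
    M.IsCodePos (s + 1) q :=
  ⟨isCutBelow_succ hq.isCutBelow (by omega), isCutBelow_succ hq.isCutBelow_add_two hle,
    hq.blockFun_eq_or, hq.blockFun_succ, hq.stageLen_ne⟩

theorem copy (hq : M.IsCodePos s q) (hlt : q + 1 < stageLen s) :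
    M.IsCodePos (s + 1) (stageLen s + 5 + q) := by
  refine ⟨isCutBelow_copy hq.isCutBelow, isCutBelow_copy hq.isCutBelow_add_two, ?_, ?_,
    _root_.stageLen_ne (s := s) (by omega) (by rw [stageLen_succ]; omega)⟩
  · have := hq.blockFun_eq_or
    rw [blockFun_copy (by omega)]
    omega
  · rw [add_assoc, blockFun_copy hlt, hq.blockFun_succ]

theorem stageLen_add (hg : g = 1 ∨ g = 3) : M.IsCodePos (s + 1) (stageLen s + g) := by
  refine ⟨isCutBelow_stageLen_add hg, ?_, ?_, ?_, _root_.stageLen_ne (s := s) (by omega)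
    (by rw [stageLen_succ]; omega)⟩
  · rcases hg with rfl | rfl
    · exact isCutBelow_stageLen_add (.inr rfl)
    · exact isCutBelow_copy (q := 0) fun i _ => by simp only [Nat.not_lt_zero]
  · rcases hg with rfl | rfl
    · exact .inl (blockFun_stageLen_add_one s)
    · exact .inr (blockFun_stageLen_add_three s)
  · rcases hg with rfl | rfl
    · exact blockFun_stageLen_add_two s
    · exact blockFun_stageLen_add_four s

end IsCodePos

namespace IsAdmissibleMove

theorem le_stageLen (h : M.IsAdmissibleMove s b g) : b ≤ stageLen s :=
  h.le_stageLen_target.trans (M.stageLen_target_le s)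

theorem gadget_le (h : M.IsAdmissibleMove s b g) : g ≤ 3 := by
  rcases h.gadget with h0 | ⟨h13, -⟩ <;> omega

theorem oldPos_strictMono (h : M.IsAdmissibleMove s b g) :
    StrictMono (oldPos (stageLen s) b g) :=
  _root_.oldPos_strictMono h.gadget_le h.le_stageLen

theorem blockFun_oldPos (h : M.IsAdmissibleMove s b g) {i : ℕ} (hi : i < stageLen s)
    (hne : g ≠ 0 → i ≠ b) :
    M.blockFun (oldPos (stageLen s) b g i) = oldPos (stageLen s) b g (M.blockFun i) := by
  have hcut := h.isCutBelow i hi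
  rcases lt_or_ge i b with hib | hib
  · rw [oldPos_of_lt hib, oldPos_of_lt (hcut.1 hib)]
  rcases h.gadget with rfl | ⟨hg, -, hb⟩
  · rw [oldPos_of_le hib (absurd rfl), oldPos_of_le (by omega) (absurd rfl), blockFun_copy hi]
  have hg0 : g ≠ 0 := by omega
  have hib' := hne hg0
  rcases (show i = b + 1 ∨ b + 2 ≤ i by omega) with rfl | hib2
  · rw [hb.blockFun_succ, oldPos_add hg0 one_lt_two]
    exact (IsCodePos.stageLen_add hg).blockFun_succ
  · have hcut2 := hb.isCutBelow_add_two i hi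
    rw [oldPos_of_le hib fun _ => hib2, oldPos_of_le (by omega) fun _ => by omega,
      blockFun_copy hi]

end IsAdmissibleMove

end Moves

variable (M : MergeSchedule) (a : ℕ → ℕ → Bool)

/-- The parameters `b` and `g` of `oldPos` at stage `s`, where `l` lists the positions before
stage `s` and `a n s` is the approximation at stage `s` to the coded set. Membership of `n` is coded
by whether the value at the element `codeName n` is its successor; at the stages `2 * ⟨n, j⟩` with
`j ≠ 0` this is adjusted to `a n s` if necessary. -/
def copyMove (s : ℕ) (l : List ℕ) : ℕ × ℕ :=
  let n := s.div2.unpair.1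
  let p := l.getD (codeName n) 0
  if s.bodd = false ∧ s.div2.unpair.2 ≠ 0 ∧ M.blockFun p ≠ p + (a n s).toNat then
    (p, 1 + 2 * (a n s).toNat)
  else (stageLen (M.target s), 0)

/-- The positions of the elements `0, …, stageLen s - 1` of the copy before stage `s`. -/
def positions : ℕ → List ℕ
  | 0 => []
  | s + 1 =>
    let m := M.copyMove a s (positions s)
    (positions s).map (oldPos (stageLen s) m.1 m.2) ++
      (List.range (stageLen s + 5)).map (newPos (stageLen s) m.1 m.2)

/-- The position before stage `s` of the element `x` of the copy (zero if `x` is not present). -/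
def pos (s x : ℕ) : ℕ := (M.positions a s).getD x 0

/-- The position from which on elements are moved at stage `s`. -/
def cut (s : ℕ) : ℕ := (M.copyMove a s (M.positions a s)).1

/-- The offset of the pair to which the coding pair at `cut` is moved at stage `s`, or zero. -/
def gadget (s : ℕ) : ℕ := (M.copyMove a s (M.positions a s)).2

variable {M a} {s x y n : ℕ}

theorem length_positions (s : ℕ) : (M.positions a s).length = stageLen s := by
  induction s with
  | zero => rfl
  | succ s ih =>
    simp only [positions, List.length_append, List.length_map, ih, List.length_range,
      stageLen_succ]
    omega

theorem positions_succ (s : ℕ) : M.positions a (s + 1) =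
    (M.positions a s).map (oldPos (stageLen s) (M.cut a s) (M.gadget a s)) ++
      (List.range (stageLen s + 5)).map (newPos (stageLen s) (M.cut a s) (M.gadget a s)) :=
  rfl

theorem pos_succ_of_lt (hx : x < stageLen s) :
    M.pos a (s + 1) x = oldPos (stageLen s) (M.cut a s) (M.gadget a s) (M.pos a s x) := by
  rw [← length_positions (M := M) (a := a)] at hx
  rw [pos, positions_succ, List.getD_append _ _ _ _ (by rwa [List.length_map]), pos,
    List.getD_eq_getElem _ _ (by rwa [List.length_map]), List.getD_eq_getElem _ _ hx,
    List.getElem_map]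

theorem pos_stageLen_add {j : ℕ} (hj : j < stageLen s + 5) :
    M.pos a (s + 1) (stageLen s + j) = newPos (stageLen s) (M.cut a s) (M.gadget a s) j := by
  have hlen (f : ℕ → ℕ) : ((M.positions a s).map f).length = stageLen s := by
    rw [List.length_map, length_positions]
  rw [pos, positions_succ, List.getD_append_right _ _ _ _ (by rw [hlen]; omega), hlen,
    Nat.add_sub_cancel_left,
    List.getD_eq_getElem _ _ (by rwa [List.length_map, List.length_range]), List.getElem_map,
    List.getElem_range]

theorem cut_gadget_cases (s : ℕ) :
    (M.gadget a s = 0 ∧ M.cut a s = stageLen (M.target s)) ∨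
      ∃ n, codeStage n < s ∧ M.target s = s ∧ M.cut a s = M.pos a s (codeName n) ∧
        (M.gadget a s = 1 ∨ M.gadget a s = 3) ∧
        M.blockFun (M.pos a s (codeName n)) ≠ M.pos a s (codeName n) + (a n s).toNat := by
  by_cases hrec : s.bodd = false ∧ s.div2.unpair.2 ≠ 0 ∧
      M.blockFun (M.pos a s (codeName s.div2.unpair.1)) ≠
        M.pos a s (codeName s.div2.unpair.1) + (a s.div2.unpair.1 s).toNat
  · have hmove : M.copyMove a s (M.positions a s) = (M.pos a s (codeName s.div2.unpair.1),
        1 + 2 * (a s.div2.unpair.1 s).toNat) := if_pos hrec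
    obtain ⟨hodd, hj, hval⟩ := hrec
    have hs : s = 2 * Nat.pair s.div2.unpair.1 s.div2.unpair.2 := by
      have := Nat.bodd_add_div2 s
      rw [hodd] at this
      simpa using this.symm
    refine .inr ⟨s.div2.unpair.1, (codeStage_lt hj).trans_eq hs.symm, ?_, ?_, ?_, hval⟩
    · rw [hs]
      exact M.target_two_mul _
    · rw [cut, hmove]
    · rw [gadget, hmove]
      cases a s.div2.unpair.1 s
      · exact .inl rfl
      · exact .inr rfl
  · have hmove : M.copyMove a s (M.positions a s) = (stageLen (M.target s), 0) := if_neg hrec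
    exact .inl ⟨by rw [gadget, hmove], by rw [cut, hmove]⟩

theorem cut_gadget_two_mul_pair {j : ℕ} (hs : s = 2 * Nat.pair n j) (hj : j ≠ 0)
    (hval : M.blockFun (M.pos a s (codeName n)) ≠ M.pos a s (codeName n) + (a n s).toNat) :
    M.cut a s = M.pos a s (codeName n) ∧ M.gadget a s = 1 + 2 * (a n s).toNat := by
  have hdiv : s.div2.unpair = (n, j) := by rw [hs, Nat.div2_bit0, Nat.unpair_pair]
  have hmove : M.copyMove a s (M.positions a s) =
      (M.pos a s (codeName n), 1 + 2 * (a n s).toNat) := by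
    rw [copyMove, hdiv]
    exact if_pos ⟨by rw [hs, Nat.bodd_mul, Nat.bodd_two, Bool.false_and], hj, hval⟩
  exact ⟨by rw [cut, hmove], by rw [gadget, hmove]⟩

theorem cut_gadget_codeStage (n : ℕ) :
    M.cut a (codeStage n) = stageLen (codeStage n) ∧ M.gadget a (codeStage n) = 0 := by
  have hdiv : (codeStage n).div2.unpair = (n, 0) := by
    rw [codeStage, Nat.div2_bit0, Nat.unpair_pair]
  have hmove : M.copyMove a (codeStage n) (M.positions a (codeStage n)) =
      (stageLen (M.target (codeStage n)), 0) := by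
    rw [copyMove, hdiv]
    exact if_neg fun h => h.2.1 rfl
  rw [cut, gadget, hmove]
  exact ⟨congrArg stageLen (M.target_two_mul _), rfl⟩

theorem pos_codeStage_succ_codeName {j : ℕ} (hj : j < 2) :
    M.pos a (codeStage n + 1) (codeName n + j) = codeName n + j := by
  obtain ⟨hcut, hgadget⟩ := M.cut_gadget_codeStage (a := a) n
  rw [codeName, add_assoc, pos_stageLen_add (by omega), hcut, hgadget, newPos,
    if_neg fun h => h.1 rfl]

end MergeSchedule
namespace MergeSchedule

section Invariants

variable {M : MergeSchedule} {a : ℕ → ℕ → Bool} {s t q x y m n : ℕ}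

theorem IsAdmissibleMove.isCodePos_oldPos {b g : ℕ} (h : M.IsAdmissibleMove s b g)
    (hq : M.IsCodePos s q) (hlt : q + 1 < stageLen s) (hsucc : q + 1 ≠ b)
    (hne : g ≠ 0 → q ≠ b + 1) :
    oldPos (stageLen s) b g (q + 1) = oldPos (stageLen s) b g q + 1 ∧
      M.IsCodePos (s + 1) (oldPos (stageLen s) b g q) := by
  have htarget := h.le_stageLen_target
  rcases (show q + 2 ≤ b ∨ (g ≠ 0 ∧ q = b) ∨ (b ≤ q ∧ (g ≠ 0 → b + 2 ≤ q)) by omega) with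
    hqb | ⟨hg, rfl⟩ | ⟨hbq, hbq2⟩
  · rw [oldPos_of_lt (by omega), oldPos_of_lt (by omega)]
    exact ⟨rfl, hq.of_le_stageLen_target (by omega)⟩
  · rw [oldPos_add hg one_lt_two, oldPos_self hg]
    exact ⟨rfl, .stageLen_add (h.gadget.resolve_left hg).1⟩
  · rw [oldPos_of_le (by omega) (by omega), oldPos_of_le hbq hbq2]
    exact ⟨rfl, hq.copy hlt⟩

/-- The invariants of the construction of the copy: before stage `s` the positions are a
permutation of `[0, stageLen s)`, and each coding pair present occupies two consecutive positions
that form a code position. -/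
structure CopyInv (M : MergeSchedule) (a : ℕ → ℕ → Bool) (s : ℕ) : Prop where
  pos_lt : ∀ {x}, x < stageLen s → M.pos a s x < stageLen s
  pos_inj : ∀ {x y}, x < stageLen s → y < stageLen s → M.pos a s x = M.pos a s y → x = y
  pos_codeName_succ : ∀ {n}, codeStage n < s →
    M.pos a s (codeName n + 1) = M.pos a s (codeName n) + 1
  isCodePos : ∀ {n}, codeStage n < s → M.IsCodePos s (M.pos a s (codeName n))

namespace CopyInv

theorem pos_codeName_succ_lt (hs : M.CopyInv a s) (hn : codeStage n < s) :
    M.pos a s (codeName n) + 1 < stageLen s :=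
  hs.pos_codeName_succ hn ▸ hs.pos_lt (codeName_succ_lt hn)

theorem isAdmissibleMove (hs : M.CopyInv a s) :
    M.IsAdmissibleMove s (M.cut a s) (M.gadget a s) := by
  rcases M.cut_gadget_cases (a := a) s with ⟨hg, hb⟩ | ⟨n, hn, htarget, hb, hg, -⟩
  · exact ⟨hb.le, hb ▸ isCutBelow_stageLen_target s, .inl hg⟩
  · have hlt := hs.pos_codeName_succ_lt hn
    have hcode := hs.isCodePos hn
    rw [← hb] at hlt hcode
    exact ⟨by rw [htarget]; omega, hcode.isCutBelow, .inr ⟨hg, hlt, hcode⟩⟩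

theorem pos_codeName_succ_ne_pos_codeName (hs : M.CopyInv a s) (hm : codeStage m < s)
    (hn : codeStage n < s) : M.pos a s (codeName m) + 1 ≠ M.pos a s (codeName n) := fun heq => by
  rw [← hs.pos_codeName_succ hm] at heq
  exact codeName_succ_ne m n (hs.pos_inj (codeName_succ_lt hm)
    (Nat.lt_of_succ_lt (codeName_succ_lt hn)) heq)

theorem pos_codeName_succ_ne_cut (hs : M.CopyInv a s) (hn : codeStage n < s) :
    M.pos a s (codeName n) + 1 ≠ M.cut a s := by
  rcases M.cut_gadget_cases (a := a) s with ⟨-, hb⟩ | ⟨m, hm, -, hb, -⟩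
  · exact fun heq => (hs.isCodePos hn).stageLen_ne _ (hb.symm.trans heq.symm)
  · exact hb ▸ hs.pos_codeName_succ_ne_pos_codeName hn hm

theorem pos_codeName_ne_cut_succ (hs : M.CopyInv a s) (hn : codeStage n < s)
    (hg : M.gadget a s ≠ 0) : M.pos a s (codeName n) ≠ M.cut a s + 1 := by
  rcases M.cut_gadget_cases (a := a) s with ⟨hg0, -⟩ | ⟨m, hm, -, hb, -⟩
  · exact absurd hg0 hg
  · exact hb ▸ (hs.pos_codeName_succ_ne_pos_codeName hm hn).symm

theorem pos_succ_codeName (hs : M.CopyInv a s) (hn : codeStage n < s) :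
    M.pos a (s + 1) (codeName n + 1) = M.pos a (s + 1) (codeName n) + 1 ∧
      M.IsCodePos (s + 1) (M.pos a (s + 1) (codeName n)) := by
  have hlt := codeName_succ_lt hn
  rw [pos_succ_of_lt hlt, pos_succ_of_lt (by omega), hs.pos_codeName_succ hn]
  exact hs.isAdmissibleMove.isCodePos_oldPos (hs.isCodePos hn) (hs.pos_codeName_succ_lt hn)
    (hs.pos_codeName_succ_ne_cut hn) (hs.pos_codeName_ne_cut_succ hn)

theorem pos_succ_lt (hs : M.CopyInv a s) (hx : x < stageLen (s + 1)) :
    M.pos a (s + 1) x < stageLen (s + 1) := by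
  have hmove := hs.isAdmissibleMove
  rw [stageLen_succ]
  rcases lt_stageLen_succ_cases hx with hx | ⟨j, hj, rfl⟩
  · rw [pos_succ_of_lt hx]
    exact oldPos_lt hmove.gadget_le (hs.pos_lt hx)
  · rw [pos_stageLen_add hj]
    exact newPos_lt hmove.le_stageLen (fun hg => (hmove.gadget.resolve_left hg).2.1) hj

theorem pos_succ_inj (hs : M.CopyInv a s) (hx : x < stageLen (s + 1)) (hy : y < stageLen (s + 1))
    (hxy : M.pos a (s + 1) x = M.pos a (s + 1) y) : x = y := by
  have hmove := hs.isAdmissibleMove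
  rcases lt_stageLen_succ_cases hx with hx | ⟨i, hi, rfl⟩ <;>
    rcases lt_stageLen_succ_cases hy with hy | ⟨j, hj, rfl⟩
  · rw [pos_succ_of_lt hx, pos_succ_of_lt hy] at hxy
    exact hs.pos_inj hx hy (hmove.oldPos_strictMono.injective hxy)
  · rw [pos_succ_of_lt hx, pos_stageLen_add hj] at hxy
    exact absurd hxy (oldPos_ne_newPos hmove.gadget_le (hs.pos_lt hx) hj)
  · rw [pos_succ_of_lt hy, pos_stageLen_add hi] at hxy
    exact absurd hxy.symm (oldPos_ne_newPos hmove.gadget_le (hs.pos_lt hy) hi)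
  · rw [pos_stageLen_add hi, pos_stageLen_add hj] at hxy
    rw [(newPos_strictMono _ _ _).injective hxy]

theorem succ (hs : M.CopyInv a s) : M.CopyInv a (s + 1) := by
  have hnew (n : ℕ) : M.pos a (codeStage n + 1) (codeName n) = codeName n :=
    pos_codeStage_succ_codeName two_pos
  refine ⟨hs.pos_succ_lt, hs.pos_succ_inj, fun {n} hn => ?_, fun {n} hn => ?_⟩ <;>
    rcases Nat.lt_succ_iff_lt_or_eq.1 hn with hn | rfl
  · exact (hs.pos_succ_codeName hn).1
  · rw [pos_codeStage_succ_codeName one_lt_two, hnew]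
  · exact (hs.pos_succ_codeName hn).2
  · rw [hnew]
    exact .stageLen_add (.inl rfl)

end CopyInv

theorem copyInv (s : ℕ) : M.CopyInv a s := by
  induction s with
  | zero =>
    refine ⟨?_, ?_, ?_, ?_⟩ <;> simp only [stageLen, Nat.not_lt_zero, false_imp_iff, implies_true]
  | succ s ih => exact ih.succ

theorem pos_lt_pos_iff (hst : s ≤ t) (hx : x < stageLen s) (hy : y < stageLen s) :
    M.pos a t x < M.pos a t y ↔ M.pos a s x < M.pos a s y := by
  induction t, hst using Nat.le_induction with
  | base => rfl
  | succ t hst ih =>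
    have hlen := stageLen_strictMono.monotone hst
    rw [← ih, pos_succ_of_lt (hx.trans_le hlen), pos_succ_of_lt (hy.trans_le hlen),
      (copyInv t).isAdmissibleMove.oldPos_strictMono.lt_iff_lt]

theorem pos_lt_pos_codeName (hn : codeStage n < s) (hx : x < stageLen (codeStage n)) :
    M.pos a s x < M.pos a s (codeName n) := by
  have hlt := (copyInv (M := M) (a := a) (codeStage n)).pos_lt hx
  have hcut := (M.cut_gadget_codeStage (a := a) n).1
  have hcode := codeName_succ_lt (codeStage n).lt_succ_self
  rw [pos_lt_pos_iff (Nat.succ_le_of_lt hn) (hx.trans (stageLen_strictMono (Nat.lt_succ_self _)))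
    (Nat.lt_of_succ_lt hcode), Nat.succ_eq_add_one, pos_succ_of_lt hx,
    oldPos_of_lt (hlt.trans_eq hcut.symm)]
  exact hlt.trans ((Nat.lt_succ_self _).trans_eq (pos_codeStage_succ_codeName two_pos).symm)

theorem exists_pos_eq {p : ℕ} (hp : p < stageLen s) : ∃ x < stageLen s, M.pos a s x = p := by
  have hsurj := Finset.surjOn_of_injOn_of_card_le (s := Finset.range (stageLen s))
    (t := Finset.range (stageLen s)) (M.pos a s)
    (fun x hx => Finset.mem_range.2 ((copyInv s).pos_lt (Finset.mem_range.1 hx)))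
    (fun x hx y hy => (copyInv s).pos_inj (Finset.mem_range.1 hx) (Finset.mem_range.1 hy)) le_rfl
  obtain ⟨x, hx, hxp⟩ := hsurj (Finset.mem_range.2 hp)
  exact ⟨x, Finset.mem_range.1 hx, hxp⟩

theorem blockFun_pos_eq_pos_iff (hst : s ≤ t) (hx : x < stageLen s) (hy : y < stageLen s)
    (hne : ∀ n, x ≠ codeName n) :
    M.blockFun (M.pos a t x) = M.pos a t y ↔ M.blockFun (M.pos a s x) = M.pos a s y := by
  induction t, hst using Nat.le_induction with
  | base => rfl
  | succ t hst ih =>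
    have hlen := stageLen_strictMono.monotone hst
    have hinv := copyInv (M := M) (a := a) t
    have hcut : M.gadget a t ≠ 0 → M.pos a t x ≠ M.cut a t := fun hg heq => by
      rcases M.cut_gadget_cases (a := a) t with ⟨hg0, -⟩ | ⟨m, hm, -, hb, -⟩
      · exact hg hg0
      · exact hne m (hinv.pos_inj (hx.trans_le hlen) (Nat.lt_of_succ_lt (codeName_succ_lt hm))
          (heq.trans hb))
    rw [← ih, pos_succ_of_lt (hx.trans_le hlen), pos_succ_of_lt (hy.trans_le hlen),
      hinv.isAdmissibleMove.blockFun_oldPos (hinv.pos_lt (hx.trans_le hlen)) hcut,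
      hinv.isAdmissibleMove.oldPos_strictMono.injective.eq_iff]

end Invariants

end MergeSchedule
/-! ### The limit of the construction -/

namespace MergeSchedule

open Filter

section Limit

variable {M : MergeSchedule} {a : ℕ → ℕ → Bool} {A : ℕ → Bool} {s x : ℕ}

theorem blockFun_pos_succ_codeName {n : ℕ} {c : Bool} (hn : codeStage n < s) (hc : a n s = c)
    (hval : M.blockFun (M.pos a s (codeName n)) = M.pos a s (codeName n) + c.toNat) :
    M.blockFun (M.pos a (s + 1) (codeName n)) = M.pos a (s + 1) (codeName n) + c.toNat := by
  have hinv := copyInv (M := M) (a := a) s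
  have hlt := Nat.lt_of_succ_lt (codeName_succ_lt hn)
  have hcut : M.gadget a s ≠ 0 → M.pos a s (codeName n) ≠ M.cut a s := fun hg heq => by
    rcases M.cut_gadget_cases (a := a) s with ⟨hg0, -⟩ | ⟨m, hm, -, hb, -, hne⟩
    · exact hg hg0
    · obtain rfl : n = m := codeName_strictMono.injective
        (hinv.pos_inj hlt (Nat.lt_of_succ_lt (codeName_succ_lt hm)) (heq.trans hb))
      exact hne (hc ▸ hval)
  have hsucc := (hinv.pos_succ_codeName hn).1
  rw [pos_succ_of_lt (codeName_succ_lt hn), hinv.pos_codeName_succ hn, pos_succ_of_lt hlt] at hsucc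
  rw [pos_succ_of_lt hlt, hinv.isAdmissibleMove.blockFun_oldPos (hinv.pos_lt hlt) hcut, hval]
  cases c
  · rfl
  · exact hsucc

theorem exists_blockFun_pos_codeName {n N : ℕ} {c : Bool} (hc : ∀ s ≥ N, a n s = c) :
    ∃ s ≥ N, codeStage n < s ∧
      M.blockFun (M.pos a s (codeName n)) = M.pos a s (codeName n) + c.toNat := by
  have hN := Nat.right_le_pair n (N + 1)
  obtain ⟨s, hs⟩ : ∃ s, s = 2 * Nat.pair n (N + 1) := ⟨_, rfl⟩
  have hns : codeStage n < s := hs ▸ codeStage_lt N.succ_ne_zero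
  by_cases hval : M.blockFun (M.pos a s (codeName n)) = M.pos a s (codeName n) + c.toNat
  · exact ⟨s, by omega, hns, hval⟩
  · obtain ⟨hcut, hgadget⟩ :=
      M.cut_gadget_two_mul_pair hs N.succ_ne_zero ((hc s (by omega)).symm ▸ hval)
    rw [hc s (by omega)] at hgadget
    refine ⟨s + 1, by omega, by omega, ?_⟩
    rw [pos_succ_of_lt (Nat.lt_of_succ_lt (codeName_succ_lt hns)), ← hcut,
      oldPos_self (by omega), hgadget]
    cases c
    · exact blockFun_stageLen_add_one s
    · exact blockFun_stageLen_add_three s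

theorem eventually_blockFun_pos_codeName {n : ℕ} {c : Bool} (hc : ∀ᶠ s in atTop, a n s = c) :
    ∀ᶠ s in atTop, M.blockFun (M.pos a s (codeName n)) = M.pos a s (codeName n) + c.toNat := by
  obtain ⟨N, hN⟩ := eventually_atTop.1 hc
  obtain ⟨S, hNS, hnS, hS⟩ := exists_blockFun_pos_codeName (M := M) hN
  refine eventually_atTop.2 ⟨S, fun s hs => ?_⟩
  induction s, hs using Nat.le_induction with
  | base => exact hS
  | succ s hs ih => exact blockFun_pos_succ_codeName (hnS.trans_le hs) (hN s (hNS.trans hs)) ih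

theorem pos_lt_cut_of_isTrueStage {T : ℕ} (hT : M.IsTrueStage T) (hTs : T < s)
    (hval : ∀ n ≤ x,
      M.blockFun (M.pos a s (codeName n)) = M.pos a s (codeName n) + (a n s).toNat)
    (hx : M.pos a s x < stageLen (T + 1)) : M.pos a s x < M.cut a s := by
  rcases M.cut_gadget_cases (a := a) s with ⟨-, hb⟩ | ⟨n, hn, -, hb, -, hne⟩
  · exact hb ▸ hx.trans_le (stageLen_strictMono.monotone (hT s hTs))
  · have hxn : x < n := not_le.1 fun hnx => hne (hval n hnx)
    exact hb ▸ pos_lt_pos_codeName hn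
      (hxn.trans_le ((le_codeStage n).trans (le_stageLen (codeStage n))))

theorem pos_eq_of_forall_pos_lt_cut {S : ℕ} (hx : x < stageLen S)
    (hcut : ∀ s ≥ S, M.pos a s x = M.pos a S x → M.pos a S x < M.cut a s) :
    ∀ s ≥ S, M.pos a s x = M.pos a S x := by
  intro s hs
  induction s, hs using Nat.le_induction with
  | base => rfl
  | succ s hs ih =>
    rw [pos_succ_of_lt (hx.trans_le (stageLen_strictMono.monotone hs)), ih,
      oldPos_of_lt (hcut s hs ih)]

theorem exists_eventually_pos_eq (hA : ∀ n, ∀ᶠ s in atTop, a n s = A n) (x : ℕ) :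
    ∃ p, ∀ᶠ s in atTop, M.pos a s x = p ∧ p < M.cut a s := by
  have hval : ∀ᶠ s in atTop, ∀ n ≤ x,
      M.blockFun (M.pos a s (codeName n)) = M.pos a s (codeName n) + (a n s).toNat :=
    (Set.finite_Iic x).eventually_all.2 fun n _ =>
      ((hA n).and (eventually_blockFun_pos_codeName (hA n))).mono fun s hs => hs.1.symm ▸ hs.2
  obtain ⟨T, hT, hxT, hval⟩ := (M.frequently_lt_target.and_eventually
    ((eventually_ge_atTop x).and (eventually_forall_ge_atTop.2 hval))).exists
  have hxlen : x < stageLen (T + 1) := (Nat.lt_succ_of_le hxT).trans_le (le_stageLen (T + 1))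
  have hlt : M.pos a (T + 1) x < stageLen (T + 1) := (copyInv _).pos_lt hxlen
  have hcut : ∀ s ≥ T + 1, M.pos a s x = M.pos a (T + 1) x → M.pos a (T + 1) x < M.cut a s :=
    fun s hs heq => heq ▸ pos_lt_cut_of_isTrueStage hT hs (hval s (by omega)) (heq.trans_lt hlt)
  have heq := pos_eq_of_forall_pos_lt_cut hxlen hcut
  exact ⟨_, eventually_atTop.2 ⟨T + 1, fun s hs => ⟨heq s hs, hcut s hs (heq s hs)⟩⟩⟩

/-- The relation that orders the elements of the copy. -/
def copyLT (M : MergeSchedule) (a : ℕ → ℕ → Bool) (x y : ℕ) : Prop :=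
  M.pos a (x + y + 1) x < M.pos a (x + y + 1) y

theorem lt_stageLen_add_add_one (x y : ℕ) :
    x < stageLen (x + y + 1) ∧ y < stageLen (x + y + 1) := by
  have := le_stageLen (x + y + 1)
  omega

theorem eventually_lt_stageLen (x : ℕ) : ∀ᶠ s in atTop, x < stageLen s :=
  (eventually_gt_atTop x).mono fun s hs => hs.trans_le (le_stageLen s)

theorem exists_limit_equiv (hA : ∀ n, ∀ᶠ s in atTop, a n s = A n) :
    ∃ φ : ℕ ≃ ℕ, ∀ x, ∀ᶠ s in atTop, M.pos a s x = φ x := by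
  choose φ hφ using exists_eventually_pos_eq (M := M) hA
  have hinj : Function.Injective φ := fun x y hxy => by
    obtain ⟨s, ⟨hx, -⟩, ⟨hy, -⟩, hxs, hys⟩ := ((hφ x).and ((hφ y).and
      ((eventually_lt_stageLen x).and (eventually_lt_stageLen y)))).exists
    exact (copyInv s).pos_inj hxs hys (hx.trans (hxy.trans hy.symm))
  have hsurj : Function.Surjective φ := fun p => by
    obtain ⟨_, ⟨x, rfl⟩, hpx⟩ := (Set.infinite_range_of_injective hinj).exists_gt p
    obtain ⟨S, hxS, hS⟩ :=
      ((eventually_lt_stageLen x).and (eventually_forall_ge_atTop.2 (hφ x))).exists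
    obtain ⟨y, hyS, rfl⟩ := exists_pos_eq (M := M) (a := a)
      (hpx.trans ((hS S le_rfl).1 ▸ (copyInv S).pos_lt hxS))
    have heq := pos_eq_of_forall_pos_lt_cut hyS fun s hs _ => hpx.trans (hS s hs).2
    obtain ⟨s, hs, hys, -⟩ := ((eventually_ge_atTop S).and (hφ y)).exists
    exact ⟨y, hys.symm.trans (heq s hs)⟩
  exact ⟨.ofBijective φ ⟨hinj, hsurj⟩, fun x => (hφ x).mono fun s => And.left⟩

variable {φ : ℕ ≃ ℕ} (hφ : ∀ x, ∀ᶠ s in atTop, M.pos a s x = φ x)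

include hφ

theorem copyLT_iff (x y : ℕ) : M.copyLT a x y ↔ φ x < φ y := by
  obtain ⟨s, hs, hx, hy⟩ :=
    ((eventually_ge_atTop (x + y + 1)).and ((hφ x).and (hφ y))).exists
  obtain ⟨hxs, hys⟩ := lt_stageLen_add_add_one x y
  rw [copyLT, ← pos_lt_pos_iff hs hxs hys, hx, hy]

theorem blockFun_limit_eq_iff (hne : ∀ n, x ≠ codeName n) (y : ℕ) :
    M.blockFun (φ x) = φ y ↔
      M.blockFun (M.pos a (x + y + 1) x) = M.pos a (x + y + 1) y := by
  obtain ⟨s, hs, hx, hy⟩ :=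
    ((eventually_ge_atTop (x + y + 1)).and ((hφ x).and (hφ y))).exists
  obtain ⟨hxs, hys⟩ := lt_stageLen_add_add_one x y
  rw [← blockFun_pos_eq_pos_iff hs hxs hys hne, hx, hy]

theorem blockFun_limit_codeName_eq_iff {n : ℕ} {c : Bool} (hc : ∀ᶠ s in atTop, a n s = c)
    (y : ℕ) : M.blockFun (φ (codeName n)) = φ y ↔ y = codeName n + c.toNat := by
  obtain ⟨s, hs, hn, hn', hval⟩ := ((eventually_gt_atTop (codeStage n)).and ((hφ (codeName n)).and
    ((hφ (codeName n + 1)).and (eventually_blockFun_pos_codeName hc)))).exists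
  have hsucc := (copyInv (M := M) (a := a) s).pos_codeName_succ hs
  rw [hn, hn'] at hsucc
  have hcode : M.blockFun (φ (codeName n)) = φ (codeName n + c.toNat) := by
    rw [← hn, hval, hn]
    cases c
    · rfl
    · exact hsucc.symm
  rw [hcode, φ.injective.eq_iff, eq_comm]

end Limit

end MergeSchedule

/-! ### Computability of the copy -/

theorem computable₂_of_succ {α β : Type*} [Primcodable α] [Primcodable β] {f : β → ℕ → α}
    {g : β × ℕ × α → α} (h_zero : Computable fun b => f b 0) (hg : Computable g)
    (h_succ : ∀ b s, f b (s + 1) = g (b, s, f b s)) : Computable₂ f := by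
  refine (Computable.nat_rec Computable.snd (h_zero.comp Computable.fst) (hg.comp
    ((Computable.fst.comp Computable.fst).pair Computable.snd)).to₂).of_eq fun x => ?_
  obtain ⟨b, s⟩ := x
  induction s with
  | zero => rfl
  | succ s ih =>
    change _ = f b (s + 1)
    rw [h_succ, ← show _ = f b s from ih]

section OldNewPos

variable {α : Type*} [Primcodable α] {k b g i : α → ℕ}

theorem primrec_oldPos (hk : Primrec k) (hb : Primrec b) (hg : Primrec g) (hi : Primrec i) :
    Primrec fun x => oldPos (k x) (b x) (g x) (i x) :=
  Primrec.ite (Primrec.nat_lt.comp hi hb) hi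
    (Primrec.ite ((Primrec.eq.comp hg (Primrec.const 0)).not.and
        (Primrec.nat_lt.comp hi (Primrec.nat_add.comp hb (Primrec.const 2))))
      (Primrec.nat_add.comp (Primrec.nat_add.comp hk hg) (Primrec.nat_sub.comp hi hb))
      (Primrec.nat_add.comp (Primrec.nat_add.comp hk (Primrec.const 5)) hi))

theorem primrec_newPos (hk : Primrec k) (hb : Primrec b) (hg : Primrec g) (hi : Primrec i) :
    Primrec fun x => newPos (k x) (b x) (g x) (i x) :=
  have hbi := Primrec.nat_add.comp hb hi
  Primrec.ite ((Primrec.eq.comp hg (Primrec.const 0)).not.and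
      (Primrec.nat_le.comp (Primrec.nat_add.comp hk hg) hbi))
    (Primrec.nat_add.comp hbi (Primrec.const 2)) hbi

end OldNewPos

theorem primrec_codeStage : Primrec codeStage :=
  Primrec.nat_mul.comp (Primrec.const 2) (Primrec₂.natPair.comp Primrec.id (Primrec.const 0))

theorem primrec_codeName : Primrec codeName :=
  Primrec.succ.comp (primrec_stageLen.comp primrec_codeStage)

namespace MergeSchedule

variable {M : MergeSchedule} {a : ℕ → ℕ → Bool}

theorem computable_copyMove (hM : Primrec M.target) (ha : Computable₂ a) :
    Computable₂ (M.copyMove a) := by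
  have hs : Computable fun p : ℕ × List ℕ => p.1 := Computable.fst
  have hunpair : Primrec fun p : ℕ × List ℕ => p.1.div2.unpair :=
    Primrec.unpair.comp (Primrec.nat_div2.comp Primrec.fst)
  have hn : Computable fun p : ℕ × List ℕ => p.1.div2.unpair.1 :=
    (Primrec.fst.comp hunpair).to_comp
  have hpos : Computable fun p : ℕ × List ℕ => p.2.getD (codeName p.1.div2.unpair.1) 0 :=
    (Primrec.list_getD 0).to_comp.comp Computable.snd (primrec_codeName.to_comp.comp hn)
  have hval : Computable fun p : ℕ × List ℕ => (a p.1.div2.unpair.1 p.1).toNat :=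
    (Primrec.dom_bool Bool.toNat).to_comp.comp (ha.comp hn hs)
  have hstage : PrimrecPred fun p : ℕ × List ℕ => p.1.bodd = false ∧ p.1.div2.unpair.2 ≠ 0 :=
    (Primrec.eq.comp (Primrec.nat_bodd.comp Primrec.fst) (Primrec.const false)).and
      (Primrec.eq.comp (Primrec.snd.comp hunpair) (Primrec.const 0)).not
  have hwrong := Primrec.not.to_comp.comp (Primrec.eq.decide.to_comp.comp
    ((primrec_blockFun hM).to_comp.comp hpos) (Primrec.nat_add.to_comp.comp hpos hval))
  have hmove := hpos.pair (Primrec.nat_add.to_comp.comp (Computable.const 1)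
    (Primrec.nat_mul.to_comp.comp (Computable.const 2) hval))
  have hstay := ((primrec_stageLen.comp hM).to_comp.comp hs).pair (Computable.const 0)
  refine (Computable.cond (Primrec.and.to_comp.comp hstage.decide.to_comp hwrong)
    hmove hstay).of_eq fun p => ?_
  rw [Bool.cond_eq_ite, copyMove]
  exact if_congr (by
    simp only [Bool.and_eq_true, decide_eq_true_eq, Bool.not_eq_true', decide_eq_false_iff_not,
      and_assoc, ne_eq]) rfl rfl

theorem computable_positions (hM : Primrec M.target) (ha : Computable₂ a) :
    Computable (M.positions a) := by
  have hstep : Primrec fun p : (ℕ × ℕ × ℕ) × List ℕ =>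
      p.2.map (oldPos p.1.1 p.1.2.1 p.1.2.2) ++
        (List.range (p.1.1 + 5)).map (newPos p.1.1 p.1.2.1 p.1.2.2) := by
    have hk : Primrec fun p : ((ℕ × ℕ × ℕ) × List ℕ) × ℕ => p.1.1.1 :=
      Primrec.fst.comp (Primrec.fst.comp Primrec.fst)
    have hm : Primrec fun p : ((ℕ × ℕ × ℕ) × List ℕ) × ℕ => p.1.1.2 :=
      Primrec.snd.comp (Primrec.fst.comp Primrec.fst)
    have hb := Primrec.fst.comp hm
    have hg := Primrec.snd.comp hm
    exact Primrec.list_append.comp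
      (Primrec.list_map Primrec.snd (primrec_oldPos hk hb hg Primrec.snd))
      (Primrec.list_map (Primrec.list_range.comp (Primrec.nat_add.comp
        (Primrec.fst.comp Primrec.fst) (Primrec.const 5))) (primrec_newPos hk hb hg Primrec.snd))
  have hs : Computable fun x : Unit × ℕ × List ℕ => x.2.1 := Computable.fst.comp Computable.snd
  have hl : Computable fun x : Unit × ℕ × List ℕ => x.2.2 := Computable.snd.comp Computable.snd
  have hmove := ((primrec_stageLen.to_comp.comp hs).pair
    ((computable_copyMove hM ha).comp hs hl)).pair hl
  exact (computable₂_of_succ (f := fun _ : Unit => M.positions a) (Computable.const [])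
    (hstep.to_comp.comp hmove) fun _ _ => rfl).comp (Computable.const ()) Computable.id

theorem computable_pos (hM : Primrec M.target) (ha : Computable₂ a) : Computable₂ (M.pos a) :=
  (Primrec.list_getD 0).to_comp.comp ((computable_positions hM ha).comp Computable.fst)
    Computable.snd

theorem computable_pos_add_succ {α : Type*} [Primcodable α] {x y z : α → ℕ} (hM : Primrec M.target)
    (ha : Computable₂ a) (hx : Computable x) (hy : Computable y) (hz : Computable z) :
    Computable fun p => M.pos a (x p + y p + 1) (z p) :=
  (computable_pos hM ha).comp (Computable.succ.comp (Primrec.nat_add.to_comp.comp hx hy)) hz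

theorem computablePred_copyLT (hM : Primrec M.target) (ha : Computable₂ a) :
    ComputablePred fun p : ℕ × ℕ => M.copyLT a p.1 p.2 := by
  have hpos {z : ℕ × ℕ → ℕ} (hz : Computable z) :=
    computable_pos_add_succ hM ha Computable.fst Computable.snd hz
  exact ComputablePred.computable_iff.2
    ⟨fun p => decide (M.pos a (p.1 + p.2 + 1) p.1 < M.pos a (p.1 + p.2 + 1) p.2),
      Primrec.nat_lt.decide.to_comp.comp (hpos Computable.fst) (hpos Computable.snd),
      funext fun _ => propext (by rw [copyLT, decide_eq_true_iff])⟩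

end MergeSchedule

/-! ### Approximations to `Δ₂` sets -/

section WitnessSearch

open Filter

/-- The search for some `c` with `p c z` for all `z`. Its state `(c, z)` consists of the current
candidate `c` and the next `z` to be checked; the first failure makes `c + 1` the candidate. -/
def witnessSearch (p : ℕ → ℕ → Bool) : ℕ → ℕ × ℕ
  | 0 => (0, 0)
  | s + 1 =>
    let w := witnessSearch p s
    bif p w.1 w.2 then (w.1, w.2 + 1) else (w.1 + 1, 0)

variable {p : ℕ → ℕ → Bool}

theorem witnessSearch_add {s c i : ℕ} (hs : witnessSearch p s = (c, 0))
    (hp : ∀ z < i, p c z = true) : witnessSearch p (s + i) = (c, i) := by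
  induction i with
  | zero => exact hs
  | succ i ih =>
    rw [← add_assoc, witnessSearch, ih fun z hz => hp z (hz.trans i.lt_succ_self)]
    exact congrArg (cond · _ _) (hp i i.lt_succ_self)

theorem exists_witnessSearch_eq {c : ℕ} (hp : ∀ b < c, ∃ z, p b z = false) :
    ∃ s, witnessSearch p s = (c, 0) := by
  induction c with
  | zero => exact ⟨0, rfl⟩
  | succ c ih =>
    obtain ⟨s, hs⟩ := ih fun b hb => hp b (hb.trans c.lt_succ_self)
    have hfail := hp c c.lt_succ_self
    refine ⟨s + Nat.find hfail + 1, ?_⟩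
    rw [witnessSearch, witnessSearch_add hs fun z hz => by simpa using Nat.find_min hfail hz]
    exact congrArg (cond · _ _) (Nat.find_spec hfail)

theorem exists_eventually_witnessSearch_eq (hp : ∃ c, ∀ z, p c z = true) :
    ∃ c, (∀ z, p c z = true) ∧ ∀ᶠ s in atTop, (witnessSearch p s).1 = c := by
  classical
  obtain ⟨s, hs⟩ := exists_witnessSearch_eq (p := p) (c := Nat.find hp) fun b hb => by
    simpa using Nat.find_min hp hb
  refine ⟨Nat.find hp, Nat.find_spec hp, eventually_atTop.2 ⟨s, fun t hst => ?_⟩⟩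
  obtain ⟨i, rfl⟩ := Nat.exists_eq_add_of_le hst
  rw [witnessSearch_add hs fun z _ => Nat.find_spec hp z]

theorem computable_witnessSearch {p : ℕ → ℕ → ℕ → Bool}
    (hp : Computable fun x : ℕ × ℕ × ℕ => p x.1 x.2.1 x.2.2) :
    Computable₂ fun n s => witnessSearch (p n) s := by
  have hstep : Computable fun x : ℕ × ℕ × ℕ =>
      bif p x.1 x.2.1 x.2.2 then (x.2.1, x.2.2 + 1) else (x.2.1 + 1, 0) :=
    Computable.cond hp
      (Primrec.fst.comp Primrec.snd |>.pair
        (Primrec.succ.comp (Primrec.snd.comp Primrec.snd))).to_comp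
      (Primrec.succ.comp (Primrec.fst.comp Primrec.snd) |>.pair (Primrec.const 0)).to_comp
  exact computable₂_of_succ (Computable.const (0, 0)) (hstep.comp
    (Computable.fst.pair (Computable.snd.comp Computable.snd))) fun _ _ => rfl

open Classical in
/-- Run the search with the witnesses for `n ∈ S` as odd candidates and those for `n ∉ S` as even
candidates, and guess by the parity of the current candidate. -/
theorem IsDelta2.exists_approximation {S : Set ℕ} (hS : IsDelta2 S) :
    ∃ a : ℕ → ℕ → Bool, Computable₂ a ∧ ∀ n, ∀ᶠ s in atTop, a n s = decide (n ∈ S) := by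
  obtain ⟨⟨R, hR, hRS⟩, ⟨Q, hQ, hQS⟩⟩ := hS
  obtain ⟨r, hr, rfl⟩ := ComputablePred.computable_iff.1 hR
  obtain ⟨q, hq, rfl⟩ := ComputablePred.computable_iff.1 hQ
  let p (n c z : ℕ) : Bool := bif c.bodd then r (n, c.div2, z) else q (n, c.div2, z)
  have hp : Computable fun x : ℕ × ℕ × ℕ => p x.1 x.2.1 x.2.2 := by
    have hc : Primrec fun x : ℕ × ℕ × ℕ => x.2.1 := Primrec.fst.comp Primrec.snd
    have harg : Computable fun x : ℕ × ℕ × ℕ => (x.1, x.2.1.div2, x.2.2) :=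
      (Primrec.fst.pair ((Primrec.nat_div2.comp hc).pair (Primrec.snd.comp Primrec.snd))).to_comp
    exact Computable.cond (Primrec.nat_bodd.comp hc).to_comp (hr.comp harg) (hq.comp harg)
  have hp_bit (n : ℕ) (b : Bool) (y z : ℕ) :
      p n (Nat.bit b y) z = bif b then r (n, y, z) else q (n, y, z) := by
    simp only [p, Nat.bodd_bit, Nat.div2_bit]
  refine ⟨fun n s => (witnessSearch (p n) s).1.bodd, Primrec.nat_bodd.to_comp.comp
    (Computable.fst.comp (computable_witnessSearch hp)), fun n => ?_⟩
  have hwitness : ∃ c, ∀ z, p n c z = true := by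
    by_cases hn : n ∈ S
    · obtain ⟨y, hy⟩ := (hRS n).1 hn
      exact ⟨Nat.bit true y, fun z => (hp_bit n true y z).trans (hy z)⟩
    · obtain ⟨y, hy⟩ := (hQS n).1 hn
      exact ⟨Nat.bit false y, fun z => (hp_bit n false y z).trans (hy z)⟩
  obtain ⟨c, hc, hlim⟩ := exists_eventually_witnessSearch_eq hwitness
  filter_upwards [hlim] with s hs
  rw [hs]
  cases hodd : c.bodd with
  | false =>
    exact (decide_eq_false ((hQS n).2 ⟨c.div2, fun z => by simpa [p, hodd] using hc z⟩)).symm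
  | true =>
    exact (decide_eq_true ((hRS n).2 ⟨c.div2, fun z => by simpa [p, hodd] using hc z⟩)).symm

end WitnessSearch

/-! ### The degree spectrum -/

theorem turingReducible_of_query {S S' : Set ℕ} {q : ℕ → ℕ} {d : ℕ → Bool → Bool}
    (hq : Computable q) (hd : Computable₂ d)
    (hS : ∀ n b, (b = true ↔ q n ∈ S') → (n ∈ S ↔ d n b = true)) :
    TuringReducible (setOracle S) (setOracle S') := by
  rw [TuringReducible, RecursiveIn.iff_nat]
  have hanswer : Nat.RecursiveIn {setOracle S'} fun m =>
      Part.some (d m.unpair.1 (decide (m.unpair.2 = 1))).toNat :=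
    Nat.Partrec.recursiveIn (Partrec.nat_iff.1 ((Primrec.dom_bool Bool.toNat).to_comp.comp
      (hd.comp (Computable.fst.comp Computable.unpair) (Primrec.eq.decide.to_comp.comp
        (Computable.snd.comp Computable.unpair) (Computable.const 1)))))
  refine Nat.RecursiveIn.of_eq (.comp hanswer (.pair (Nat.Partrec.recursiveIn Nat.Partrec.some)
    (.comp (.oracle _ rfl) (Nat.Partrec.recursiveIn (Partrec.nat_iff.1 hq))))) fun n => ?_
  have horacle : (Part.some (q n) >>= setOracle S') = setOracle S' (q n) := Part.bind_some _ _
  by_cases hmem : q n ∈ S'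
  · have hn := hS n true (iff_of_true rfl hmem)
    cases hdn : d n true <;> simp [horacle, setOracle, hn, hmem, hdn, Seq.seq]
  · have hn := hS n false (iff_of_false Bool.false_ne_true hmem)
    cases hdn : d n false <;> simp [horacle, setOracle, hn, hmem, hdn, Seq.seq]

/-- The left inverse of `codeName` that returns the greatest `n ≤ x` with `codeName n ≤ x`. -/
def codeIndex (x : ℕ) : ℕ := Nat.findGreatest (fun n => codeName n ≤ x) x

theorem primrec_codeIndex : Primrec codeIndex :=
  Primrec.nat_findGreatest Primrec.id
    (Primrec.nat_le.comp (primrec_codeName.comp Primrec.snd) Primrec.fst)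

theorem codeIndex_codeName (n : ℕ) : codeIndex (codeName n) = n := by
  have hn : n ≤ codeName n := codeName_strictMono.le_apply
  exact le_antisymm
    (codeName_strictMono.le_iff_le.1
      (Nat.findGreatest_spec (P := fun m => codeName m ≤ codeName n) hn le_rfl))
    (Nat.le_findGreatest (P := fun m => codeName m ≤ codeName n) hn le_rfl)

namespace MergeSchedule

section Graph

open Filter

variable {M : MergeSchedule} {a : ℕ → ℕ → Bool} {S : Set ℕ} {φ : ℕ ≃ ℕ}

open Classical in
theorem turingReducible_limit_graph (hA : ∀ n, ∀ᶠ s in atTop, a n s = decide (n ∈ S))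
    (hφ : ∀ x, ∀ᶠ s in atTop, M.pos a s x = φ x) :
    TuringReducible (setOracle S)
      (setOracle {m | M.blockFun (φ m.unpair.1) = φ m.unpair.2}) := by
  refine turingReducible_of_query (q := fun n => Nat.pair (codeName n) (codeName n + 1))
    (d := fun _ b => b) (Primrec₂.natPair.comp primrec_codeName
      (Primrec.succ.comp primrec_codeName)).to_comp Computable.snd fun n b hb => ?_
  rw [hb, Set.mem_ofPred_eq, Nat.unpair_pair, blockFun_limit_codeName_eq_iff hφ (hA n)]
  by_cases hn : n ∈ S <;> simp [hn]

open Classical in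
theorem limit_graph_turingReducible (hM : Primrec M.target) (ha : Computable₂ a)
    (hA : ∀ n, ∀ᶠ s in atTop, a n s = decide (n ∈ S))
    (hφ : ∀ x, ∀ᶠ s in atTop, M.pos a s x = φ x) :
    TuringReducible (setOracle {m | M.blockFun (φ m.unpair.1) = φ m.unpair.2})
      (setOracle S) := by
  have hfst : Primrec fun p : ℕ × Bool => p.1.unpair.1 :=
    Primrec.fst.comp (Primrec.unpair.comp Primrec.fst)
  have hsnd : Primrec fun p : ℕ × Bool => p.1.unpair.2 :=
    Primrec.snd.comp (Primrec.unpair.comp Primrec.fst)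
  have hpos {z : ℕ × Bool → ℕ} (hz : Primrec z) :=
    computable_pos_add_succ hM ha hfst.to_comp hsnd.to_comp hz.to_comp
  have hcond := Computable.cond
    (Primrec.eq.decide.comp (primrec_codeName.comp (primrec_codeIndex.comp hfst)) hfst).to_comp
    (Primrec.eq.decide.comp hsnd (Primrec.nat_add.comp hfst
      ((Primrec.dom_bool Bool.toNat).comp Primrec.snd))).to_comp
    (Primrec.eq.decide.to_comp.comp ((primrec_blockFun hM).to_comp.comp (hpos hfst)) (hpos hsnd))
  refine turingReducible_of_query (q := fun m => codeIndex m.unpair.1)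
    (primrec_codeIndex.comp (Primrec.fst.comp Primrec.unpair)).to_comp hcond.to₂ fun m b hb => ?_
  rw [Set.mem_ofPred_eq]
  by_cases hcode : codeName (codeIndex m.unpair.1) = m.unpair.1
  · have hlim : ∀ᶠ s in atTop, a (codeIndex m.unpair.1) s = b :=
      (hA _).mono fun s hs => hs.trans (Bool.eq_iff_iff.2 (decide_eq_true_iff.trans hb.symm))
    have hiff := blockFun_limit_codeName_eq_iff hφ hlim m.unpair.2
    rw [hcode] at hiff
    rw [hiff, decide_eq_true hcode, cond_true, decide_eq_true_iff]
  · rw [blockFun_limit_eq_iff hφ fun n hn => hcode (by rw [hn, codeIndex_codeName]),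
      decide_eq_false hcode, cond_false, decide_eq_true_iff]

end Graph

theorem setOf_isDelta2Degree_subset_degSpecFun {M : MergeSchedule} (hM : Primrec M.target) :
    {d : TuringDegree | IsDelta2Degree d} ⊆ degSpecFun M.blockFun := by
  rintro _ ⟨S, hS, rfl⟩
  obtain ⟨a, ha, hA⟩ := hS.exists_approximation
  obtain ⟨φ, hφ⟩ := M.exists_limit_equiv hA
  let ψ : ((· < ·) : ℕ → ℕ → Prop) ≃r M.copyLT a :=
    ⟨φ.symm, fun {x y} => by rw [copyLT_iff hφ, φ.apply_symm_apply, φ.apply_symm_apply]⟩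
  refine ⟨M.copyLT a, ⟨computablePred_copyLT hM ha, ⟨ψ⟩⟩, ψ, ?_⟩
  have hmap (x y : ℕ) : Relation.Map (M.blockFun · = ·) ψ ψ x y ↔ M.blockFun (φ x) = φ y := by
    rw [← Relation.map_apply_apply ψ.injective ψ.injective (M.blockFun · = ·)]
    exact iff_of_eq (congrArg₂ _ (φ.symm_apply_apply x) (φ.symm_apply_apply y)).symm
  simp only [degRel, hmap]
  exact Quotient.sound ⟨turingReducible_limit_graph hA hφ, limit_graph_turingReducible hM ha hA hφ⟩

end MergeSchedule

theorem mainTheorem2 :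
    ∃ f : ℕ → ℕ, Computable f ∧ IsBlockFunction f ∧
      ¬ Computable (cp f) ∧
      (∀ I : Set ℕ, IsFBlock f I → {J : Set ℕ | IsFBlock f J ∧ SameFType f I J}.Infinite) ∧
      {d : TuringDegree | IsDelta2Degree d} ⊆ degSpecFun f := by
  let M := witnessSchedule haltsFirstAt
  have hM : Primrec M.target := primrec_dekkerTarget (primrec_witnessEnum primrec_haltsFirstAt)
  exact ⟨M.blockFun, (M.primrec_blockFun hM).to_comp, M.isBlockFunction_blockFun,
    not_computable_cp, fun _ => M.infinite_setOf_isFBlock_sameFType,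
    M.setOf_isDelta2Degree_subset_degSpecFun hM⟩
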